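/- Theorem 1. There is a universal constant $C>0$ with the following property. Let $\mathcal M=(\mathbb R^D,\mathcal A,P,R,\mu,\gamma)$ be a Markov decision process with state space $\mathbb R^D$, discrete (countable) action space $\mathcal A$, rewards $R(s,a)\in[0,1]$, initial distribution $\mu$ and discount factor $\gamma\in[0,1)$. For a possibly time- and history-dependent randomized policy $\pi$, let $V^\pi=\mathbb E\big[\sum_{t\ge0}\gamma^tR(s_t,\pi_t(s_{0:t}))\big]$, where $R(s,p)=\mathbb E_{a\sim p}R(s,a)$; let $V^*=\sup_\pi V^\pi$, and let $d^\pi=(1-\gamma)\sum_{t\ge0}\gamma^t\,\mathbb P^\pi(s_t\in\cdot)$ be the discounted state occupancy distribution. Let $\pi^*:\mathbb R^D\to\Delta(\mathcal A)$ be an optimal stationary policy, $V^{\pi^*}=V^*$, and let the backdoor policy $\pi^\dagger:\mathbb R^D\to\Delta(\mathcal A)$ agree with $\pi^*$ on the support of $d^{\pi^*}$. Assume that $d^{\pi^*}$ has mean $0$, and let $\Sigma=\mathbb E_{s\sim d^{\pi^*}}[ss^\top]=\sum_{i=1}^D\lambda_iu_iu_i^\top$ with $u_1,\dots,u_D$ orthonormal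 and $\lambda_1\ge\dots\ge\lambda_D$. Let $1\le d<D$ be such that $\delta_*=\lambda_d-\lambda_{d+1}>0$, and let $E=\mathrm{span}(u_1,\dots,u_d)$, $E^\perp=\mathrm{span}(u_{d+1},\dots,u_D)$. Assume: (1) $d^{\pi^*}$ has bounded support along $E^\perp$, i.e. for some $C_0$, $\|\mathrm{Proj}_{E^\perp}(s)\|_2\le C_0$ for $d^{\pi^*}$-almost every $s$; and $d^{\pi^*}$ is $K$-sub-Gaussian, i.e. for $s\sim d^{\pi^*}$ and every $x\in\mathbb R^D$, $\|\langle s,x\rangle\|_{\psi_2}$ is finite and $\|\langle s,x\rangle\|_{\psi_2}\le K\,\|\langle s,x\rangle\|_{L^2}$, where $\|Y\|_{\psi_2}=\inf\{t>0:\mathbb E\,e^{Y^2/t^2}\le2\}$. (2) $\pi^\dagger$ is $L$-Lipschitz: $\|\pi^\dagger(s)-\pi^\dagger(s')\|_1\le L\|s-s'\|_2$ for all $s,s'\in\mathbb R^D$. (3) The (adaptive) trigger function $f$ maps every finite state history to $E^\perp$. For a stationary policy $\pi$ let $\pi\circ f$ be the history-dependent policy that at time $t$ draws its action from $\pi(s_t+f(s_{0:t}))$,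 while transition and reward use the true state $s_t$. For every stationary policy $\pi$ and every $t\ge0$, the perceived state satisfies $\mathbb E\,\|s_t+f(s_{0:t})\|_2\le B$ under $\pi\circ f$ (the expectation being finite). Let $\epsilon,\delta>0$, let $s_1,\dots,s_n$ be i.i.d. samples from $d^{\pi^\dagger}$, and let $\Sigma_n=\frac1n\sum_{j=1}^ns_js_j^\top$. If $$n\ \ge\ \frac{C\,d\,B^2L^2K^4\,\|\Sigma\|_2^2}{\delta_*^2(1-\gamma)^4\epsilon^2}\Big(D+\log\frac2\delta\Big),$$ then, with probability at least $1-\delta$, for every eigendecomposition $\Sigma_n=\sum_{i=1}^D\hat\lambda_i\hat u_i\hat u_i^\top$ with $\hat u_1,\dots,\hat u_D$ orthonormal and $\hat\lambda_1\ge\dots\ge\hat\lambda_D$, the sanitized policy $\pi^\dagger_{E_n}(s)=\pi^\dagger(\mathrm{Proj}_{E_n}(s))$, where $E_n=\mathrm{span}(\hat u_1,\dots,\hat u_d)$, satisfies $$V^*-V^{\pi^\dagger_{E_n}\circ f}\ \le\ \frac{L}{(1-\gamma)^2}\sqrt{\sum_{i=d+1}^D\lambda_i}\;+\;\epsilon .$$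 -/

import Mathlib

open MeasureTheory ProbabilityTheory

noncomputable section

namespace Backdoor

/-- The state space `ℝ^D` with its Euclidean norm. -/
abbrev State (D : ℕ) : Type := EuclideanSpace ℝ (Fin D)

/-- State histories `s_{0:t} = (s_0, …, s_t)`. -/
abbrev Hist (D t : ℕ) : Type := (_ : Finset.Iic t) → State D

/-- The current state `s_t` of a history `s_{0:t}`. -/
def Hist.last {D t : ℕ} (h : Hist D t) : State D := h ⟨t, Finset.mem_Iic.2 le_rfl⟩

lemma Hist.measurable_last {D t : ℕ} : Measurable (Hist.last : Hist D t → State D) :=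
  measurable_pi_apply _

/-- An MDP with state space `ℝ^D`, action space `A`, rewards in `[0,1]`, and discount factor in
`[0,1)`. -/
structure MDP (D : ℕ) (A : Type*) [MeasurableSpace A] where
  /-- transition probabilities -/
  P : Kernel (State D × A) (State D)
  isMarkov_P : IsMarkovKernel P
  /-- reward function -/
  R : State D → A → ℝ
  measurable_R : Measurable (Function.uncurry R)
  R_mem : ∀ s a, R s a ∈ Set.Icc (0 : ℝ) 1
  /-- initial state distribution -/
  μ : Measure (State D)
  isProb_μ : IsProbabilityMeasure μ
  /-- discount factor -/
  γ : ℝ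
  γ_nonneg : 0 ≤ γ
  γ_lt_one : γ < 1

attribute [instance] MDP.isMarkov_P MDP.isProb_μ

/-- A stationary Markov randomized policy `S → Δ(A)`. -/
structure Policy (D : ℕ) (A : Type*) [MeasurableSpace A] where
  act : Kernel (State D) A
  isMarkov : IsMarkovKernel act

/-- A (time and history dependent, randomized) policy: the action at time `t` is drawn from a
distribution depending on `s_{0:t}`. -/
structure HPolicy (D : ℕ) (A : Type*) [MeasurableSpace A] where
  act : (t : ℕ) → Kernel (Hist D t) A
  isMarkov : ∀ t, IsMarkovKernel (act t)

attribute [instance] Policy.isMarkov HPolicy.isMarkov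

/-- An adaptive trigger function on the set of finite state sequences, with values in `ℝ^D`. -/
structure Trigger (D : ℕ) where
  fn : (t : ℕ) → Hist D t → State D
  measurable_fn : ∀ t, Measurable (fn t)

variable {D : ℕ} {A : Type*} [MeasurableSpace A]

/-- The perceived triggered state `s_t + f(s_{0:t})`. -/
def Trigger.perceived (f : Trigger D) (t : ℕ) (h : Hist D t) : State D := h.last + f.fn t h

lemma Trigger.measurable_perceived (f : Trigger D) (t : ℕ) : Measurable (f.perceived t) :=
  Hist.measurable_last.add (f.measurable_fn t)

/-- A stationary Markov policy regarded as a history dependent one: the action at time `t` is drawn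
from `π(s_t)`. -/
def Policy.toHPolicy (π : Policy D A) : HPolicy D A where
  act _ := π.act.comap Hist.last Hist.measurable_last
  isMarkov _ := inferInstance

/-- The composition `π ∘ f`: the action at time `t` is drawn from `π(s_t + f(s_{0:t}))`. -/
def Policy.triggered (π : Policy D A) (f : Trigger D) : HPolicy D A where
  act t := π.act.comap (f.perceived t) (f.measurable_perceived t)
  isMarkov _ := inferInstance

/-- The policy `s ↦ π(T s)`. -/
def Policy.precomp (π : Policy D A) (T : State D →L[ℝ] State D) : Policy D A where
  act := π.act.comap T T.measurable
  isMarkov := inferInstance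

namespace MDP

variable (M : MDP D A)

/-- The conditional law of `s_{t+1}` given `s_{0:t}`: draw `a ∼ π_t(s_{0:t})`, then
`s_{t+1} ∼ P(· | s_t, a)`. The transition uses the true state `s_t`. -/
def step (π : HPolicy D A) (t : ℕ) : Kernel (Hist D t) (State D) :=
  M.P ∘ₖ (Kernel.deterministic Hist.last Hist.measurable_last ×ₖ π.act t)

instance (π : HPolicy D A) (t : ℕ) : IsMarkovKernel (M.step π t) := by
  unfold step; infer_instance

/-- The law of the state trajectory `(s_0, s_1, …)` under the policy `π`. -/
def traj (π : HPolicy D A) : Measure (ℕ → State D) :=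
  Kernel.trajMeasure (X := fun _ ↦ State D) M.μ (M.step π)

instance (π : HPolicy D A) : IsProbabilityMeasure (M.traj π) := by
  unfold traj; infer_instance

/-- The value `V^π = 𝔼[∑_t γ^t R(s_t, π_t(s_{0:t}))]`, where `R(s, p) = 𝔼_{a ∼ p} R(s, a)`. -/
def value (π : HPolicy D A) : ℝ :=
  ∫ s, ∑' t : ℕ, M.γ ^ t *
    ∫ a, M.R (s t) a ∂(π.act t (Preorder.frestrictLe (π := fun _ ↦ State D) t s)) ∂(M.traj π)

/-- The optimal value `V^*`, over all policies. -/
def optValue : ℝ := ⨆ π : HPolicy D A, M.value π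

/-- The discounted state occupancy distribution `(1-γ) ∑_t γ^t ℙ(s_t ∈ ·)`. -/
def occupancy (π : HPolicy D A) : Measure (State D) :=
  ENNReal.ofReal (1 - M.γ) •
    Measure.sum fun t : ℕ ↦ ENNReal.ofReal (M.γ ^ t) • (M.traj π).map (fun s ↦ s t)

end MDP

/-- Lipschitz continuity `‖π(s) - π(s')‖₁ ≤ L ‖s - s'‖₂`. -/
def Policy.IsLipschitz (π : Policy D A) (L : ℝ) : Prop :=
  ∀ s s' : State D, ∑' a : A, |(π.act s).real {a} - (π.act s').real {a}| ≤ L * ‖s - s'‖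

/-- The perceived triggered states are `B`-bounded in expectation at every time step, whatever
policy the agent uses. -/
def Trigger.IsBoundedInExpectation (f : Trigger D) (M : MDP D A) (B : ℝ) : Prop :=
  ∀ (π : Policy D A) (t : ℕ),
    Integrable (fun s ↦ f.perceived t (Preorder.frestrictLe (π := fun _ ↦ State D) t s))
      (M.traj (π.triggered f)) ∧
    ∫ s, ‖f.perceived t (Preorder.frestrictLe (π := fun _ ↦ State D) t s)‖
      ∂(M.traj (π.triggered f)) ≤ B

/-- The sub-Gaussian norm `‖Y‖_{ψ₂} = inf {t > 0 | 𝔼 exp(Y²/t²) ≤ 2}` (`∞` if there is no such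
`t`). -/
def psi2Norm {Ω : Type*} [MeasurableSpace Ω] (ν : Measure Ω) (Y : Ω → ℝ) : ENNReal :=
  ⨅ (t : ℝ) (_ : 0 < t ∧ ∫⁻ ω, ENNReal.ofReal (Real.exp (Y ω ^ 2 / t ^ 2)) ∂ν ≤ 2),
    ENNReal.ofReal t

/-- `ν` is `K`-sub-Gaussian: every one-dimensional marginal is sub-Gaussian, with
`‖⟨X, v⟩‖_{ψ₂} ≤ K ‖⟨X, v⟩‖_{L²}`. -/
def IsSubGaussian (ν : Measure (State D)) (K : ℝ) : Prop :=
  ∀ v : State D, psi2Norm ν (fun x ↦ inner ℝ x v) < ⊤ ∧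
    psi2Norm ν (fun x ↦ inner ℝ x v) ≤ ENNReal.ofReal K * eLpNorm (fun x ↦ inner ℝ x v) 2 ν

/-- The second moment matrix `𝔼[s sᵀ]` (the covariance matrix if the mean is `0`). -/
def secondMoment (ν : Measure (State D)) : Matrix (Fin D) (Fin D) ℝ :=
  Matrix.of fun i j ↦ ∫ s, s i * s j ∂ν

/-- The empirical covariance matrix `(1/n) ∑_j s_j s_jᵀ`. -/
def empCov {n : ℕ} (x : Fin n → State D) : Matrix (Fin D) (Fin D) ℝ :=
  (1 / (n : ℝ)) • ∑ j, Matrix.vecMulVec (x j) (x j)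

/-- `S = ∑ i, lam i • u i (u i)ᵀ` is an eigendecomposition with non-increasing eigenvalues
(indices start at `0`, so `lam i` is the `(i+1)`-st largest eigenvalue). -/
structure IsEigenDecomp (S : Matrix (Fin D) (Fin D) ℝ)
    (u : OrthonormalBasis (Fin D) ℝ (State D)) (lam : Fin D → ℝ) : Prop where
  antitone : Antitone lam
  eq_sum : S = ∑ i, lam i • Matrix.vecMulVec (u i) (u i)

/-- The span of the first `d` basis vectors. -/
def topSpace (u : OrthonormalBasis (Fin D) ℝ (State D)) (d : ℕ) : Submodule ℝ (State D) :=
  Submodule.span ℝ (u '' {i : Fin D | (i : ℕ) < d})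

/-- The span of the remaining basis vectors. -/
def botSpace (u : OrthonormalBasis (Fin D) ℝ (State D)) (d : ℕ) : Submodule ℝ (State D) :=
  Submodule.span ℝ (u '' {i : Fin D | d ≤ (i : ℕ)})

/-- Orthogonal projection onto `topSpace u d`, i.e. `∑_{i ≤ d} u_i u_iᵀ`. -/
def topProj (u : OrthonormalBasis (Fin D) ℝ (State D)) (d : ℕ) : State D →L[ℝ] State D :=
  (topSpace u d).starProjection

/-- Orthogonal projection onto `botSpace u d`, i.e. `∑_{i > d} u_i u_iᵀ`. -/
def botProj (u : OrthonormalBasis (Fin D) ℝ (State D)) (d : ℕ) : State D →L[ℝ] State D :=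
  (botSpace u d).starProjection

/-- The spectral norm of a matrix. -/
def specNorm (S : Matrix (Fin D) (Fin D) ℝ) : ℝ := ‖Matrix.toEuclideanCLM (n := Fin D) (𝕜 := ℝ) S‖

end Backdoor

end

/-! Let `P` be the projection onto the true top eigenspace. It is linear and kills every trigger, so
the policy sanitized with `P` plays the same with or without the trigger. On clean states it differs
from the optimal policy only through the distance from `s` to `P s`, whose mean is at most the
square root of the discarded eigenvalues. Replacing `P` by the empirical projection `Q` then costs a
multiple of `L * B * ‖P - Q‖`.

Both comparisons are instances of `abs_value_sub_le`: errors in the action law along the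
trajectories of one reference policy control the difference of values. The reference is the optimal
policy in `abs_value_sub_precomp_le` and a triggered one in `abs_value_triggered_precomp_sub_le`;
`optValue_sub_value_le` adds the two.

It remains to make `‖P - Q‖` small. `gap_sq_mul_norm_topProj_sub_sq_le` (Davis–Kahan) reduces this
to the operator norm of the covariance error, which `exists_event_norm_sub_le` bounds by Bernstein's
inequality on a net of the sphere. The samples come from the backdoor policy, but by
`occupancy_congr` its occupancy is the clean one. -/

noncomputable section

namespace Backdoor

/-! ### History laws, the hybrid argument and differences of values. -/

section

/-- Append a new state to a history. -/
def Hist.snoc {D t : ℕ} (p : Hist D t × State D) : Hist D (t + 1) :=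
  fun i ↦ if h : (i : ℕ) ≤ t then p.1 ⟨i, Finset.mem_Iic.2 h⟩ else p.2

lemma Hist.measurable_snoc {D t : ℕ} : Measurable (Hist.snoc : Hist D t × State D → _) := by
  refine measurable_pi_lambda _ fun i ↦ ?_
  unfold Hist.snoc
  split_ifs <;> fun_prop

lemma Hist.snoc_frestrictLe {D : ℕ} (t : ℕ) (x : ℕ → State D) :
    Hist.snoc (Preorder.frestrictLe (π := fun _ ↦ State D) t x, x (t + 1))
      = Preorder.frestrictLe (π := fun _ ↦ State D) (t + 1) x := by
  funext i
  have hi := Finset.mem_Iic.1 i.2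
  unfold Hist.snoc
  split_ifs with h
  · rfl
  · have : (i : ℕ) = t + 1 := by omega
    simp [Preorder.frestrictLe, ← this]

variable {D : ℕ} {A : Type*} [MeasurableSpace A]

namespace MDP

variable (M : MDP D A)

/-- The law of the history `s_{0:t}` under the policy `π`. -/
def histLaw (π : HPolicy D A) (t : ℕ) : Measure (Hist D t) :=
  (M.traj π).map (Preorder.frestrictLe (π := fun _ ↦ State D) t)

instance (π : HPolicy D A) (t : ℕ) : IsProbabilityMeasure (M.histLaw π t) :=
  Measure.isProbabilityMeasure_map (by fun_prop)

lemma histLaw_zero (π : HPolicy D A) :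
    M.histLaw π 0 = M.μ.map (MeasurableEquiv.piUnique _).symm := by
  rw [histLaw, traj, Kernel.trajMeasure, Measure.map_comp _ _ (by fun_prop),
    Kernel.traj_map_frestrictLe, Kernel.partialTraj_self, Measure.id_comp]

lemma histLaw_succ (π : HPolicy D A) (t : ℕ) :
    M.histLaw π (t + 1) = (M.histLaw π t ⊗ₘ M.step π t).map Hist.snoc := by
  rw [histLaw, histLaw, traj, Kernel.map_frestrictLe_trajMeasure_compProd_eq_map_trajMeasure,
    Measure.map_map Hist.measurable_snoc (by fun_prop)]
  congr 1
  funext x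
  exact (Hist.snoc_frestrictLe t x).symm

lemma integrable_of_mem_Icc {α : Type*} [MeasurableSpace α] {ν : Measure α} [IsFiniteMeasure ν]
    {g : α → ℝ} (hg : Measurable g) (h : ∀ x, g x ∈ Set.Icc (0 : ℝ) 1) : Integrable g ν :=
  Integrable.of_mem_Icc 0 1 hg.aemeasurable (.of_forall h)

lemma integral_mem_Icc {α : Type*} [MeasurableSpace α] {ν : Measure α} [IsProbabilityMeasure ν]
    {g : α → ℝ} (hg : Measurable g) (h : ∀ x, g x ∈ Set.Icc (0 : ℝ) 1) :
    ∫ x, g x ∂ν ∈ Set.Icc (0 : ℝ) 1 := by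
  refine ⟨integral_nonneg fun x ↦ (h x).1, ?_⟩
  calc ∫ x, g x ∂ν ≤ ∫ _, (1 : ℝ) ∂ν :=
        integral_mono (integrable_of_mem_Icc hg h) (integrable_const _) fun x ↦ (h x).2
    _ = 1 := by simp

/-- This isolates the action at time `t`, the only place in the last step where two policies differ.
-/
lemma integral_histLaw_succ (π : HPolicy D A) (t : ℕ) {g : Hist D (t + 1) → ℝ}
    (hg : Measurable g) (h01 : ∀ h, g h ∈ Set.Icc (0 : ℝ) 1) :
    ∫ h, g h ∂(M.histLaw π (t + 1))
      = ∫ h, ∫ a, ∫ s, g (Hist.snoc (h, s)) ∂(M.P (h.last, a)) ∂(π.act t h)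
          ∂(M.histLaw π t) := by
  rw [histLaw_succ, integral_map Hist.measurable_snoc.aemeasurable hg.aestronglyMeasurable,
    Measure.integral_compProd (f := fun p ↦ g (Hist.snoc p))
      (integrable_of_mem_Icc (hg.comp Hist.measurable_snoc) fun _ ↦ h01 _)]
  refine integral_congr_ae (.of_forall fun h ↦ ?_)
  have hm : Measurable fun s ↦ g (Hist.snoc (h, s)) :=
    hg.comp (Hist.measurable_snoc.comp measurable_prodMk_left)
  simp only [step]
  rw [Kernel.integral_comp (integrable_of_mem_Icc hm fun _ ↦ h01 _), Kernel.prod_apply,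
    Kernel.deterministic_apply, Measure.dirac_prod, integral_map measurable_prodMk_left.aemeasurable]
  exact (hm.stronglyMeasurable.integral_kernel (κ := M.P)).aestronglyMeasurable

end MDP

/-- The two action distributions integrate every `[0,1]`-valued function to within `b`. -/
def ActClose (p q : Measure A) (b : ℝ) : Prop :=
  ∀ φ : A → ℝ, Measurable φ → (∀ a, φ a ∈ Set.Icc (0 : ℝ) 1) →
    |∫ a, φ a ∂p - ∫ a, φ a ∂q| ≤ b

namespace MDP

variable (M : MDP D A)

lemma measurable_reward (π : HPolicy D A) (t : ℕ) :
    Measurable fun h : Hist D t ↦ ∫ a, M.R h.last a ∂(π.act t h) := by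
  have : Measurable fun p : Hist D t × A ↦ M.R p.1.last p.2 :=
    M.measurable_R.comp ((Hist.measurable_last.comp measurable_fst).prodMk measurable_snd)
  exact (this.stronglyMeasurable.integral_kernel_prod_right' (κ := π.act t)).measurable

lemma measurable_nextInt (t : ℕ) {g : Hist D (t + 1) → ℝ}
    (hg : Measurable g) : Measurable fun p : Hist D t × A ↦
      ∫ s, g (Hist.snoc (p.1, s)) ∂(M.P (p.1.last, p.2)) := by
  let κ : Kernel (Hist D t × A) (State D) := M.P.comap (fun p ↦ (p.1.last, p.2))
    ((Hist.measurable_last.comp measurable_fst).prodMk measurable_snd)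
  have : Measurable fun q : (Hist D t × A) × State D ↦ g (Hist.snoc (q.1.1, q.2)) :=
    hg.comp (Hist.measurable_snoc.comp (by fun_prop))
  exact (this.stronglyMeasurable.integral_kernel_prod_right' (κ := κ)).measurable

/-- Hybrid argument: two policies whose action distributions are close along the histories of the
first one have close history laws. -/
lemma abs_integral_histLaw_sub_le (π π' : HPolicy D A) (b : (t : ℕ) → Hist D t → ℝ) (t : ℕ)
    (hint : ∀ k < t, Integrable (b k) (M.histLaw π k))
    (hb : ∀ k < t, ∀ᵐ h ∂(M.histLaw π k), ActClose (π.act k h) (π'.act k h) (b k h))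
    {g : Hist D t → ℝ} (hg : Measurable g) (h01 : ∀ h, g h ∈ Set.Icc (0 : ℝ) 1) :
    |∫ h, g h ∂(M.histLaw π t) - ∫ h, g h ∂(M.histLaw π' t)|
      ≤ ∑ k ∈ Finset.range t, ∫ h, b k h ∂(M.histLaw π k) := by
  induction t with
  | zero => simp [histLaw_zero]
  | succ t ih =>
    rw [M.integral_histLaw_succ π t hg h01, M.integral_histLaw_succ π' t hg h01,
      Finset.sum_range_succ]
    have hm := M.measurable_nextInt t hg
    set q : Hist D t × A → ℝ := fun p ↦ ∫ s, g (Hist.snoc (p.1, s)) ∂(M.P (p.1.last, p.2)) with hq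
    have hq01 : ∀ p, q p ∈ Set.Icc (0 : ℝ) 1 := fun p ↦
      integral_mem_Icc (hg.comp (Hist.measurable_snoc.comp measurable_prodMk_left)) fun _ ↦ h01 _
    have hqm : ∀ ρ : HPolicy D A, Measurable fun h ↦ ∫ a, q (h, a) ∂(ρ.act t h) := fun ρ ↦
      (hm.stronglyMeasurable.integral_kernel_prod_right' (κ := ρ.act t)).measurable
    have hq01' : ∀ (ρ : HPolicy D A) h, ∫ a, q (h, a) ∂(ρ.act t h) ∈ Set.Icc (0 : ℝ) 1 := fun ρ h ↦
      integral_mem_Icc (hm.comp measurable_prodMk_left) fun _ ↦ hq01 _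
    -- The intermediate process follows `π` before time `t` and `π'` at time `t`. The induction
    -- hypothesis swaps the past, `h2` swaps the last action.
    have h1 := ih (fun k hk ↦ hint k (by omega)) (fun k hk ↦ hb k (by omega)) (hqm π') (hq01' π')
    have h2 : |∫ h, ∫ a, q (h, a) ∂(π.act t h) ∂(M.histLaw π t)
        - ∫ h, ∫ a, q (h, a) ∂(π'.act t h) ∂(M.histLaw π t)| ≤ ∫ h, b t h ∂(M.histLaw π t) := by
      rw [← integral_sub (integrable_of_mem_Icc (hqm π) (hq01' π))
        (integrable_of_mem_Icc (hqm π') (hq01' π'))]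
      refine (abs_integral_le_integral_abs).trans (integral_mono_ae ?_ (hint t (by omega)) ?_)
      · exact ((integrable_of_mem_Icc (hqm π) (hq01' π)).sub
          (integrable_of_mem_Icc (hqm π') (hq01' π'))).abs
      · filter_upwards [hb t (by omega)] with h hh
        exact hh _ (hm.comp measurable_prodMk_left) fun _ ↦ hq01 _
    calc _ ≤ _ := abs_sub_le _ (∫ h, ∫ a, q (h, a) ∂(π'.act t h) ∂(M.histLaw π t)) _
      _ ≤ _ := by linarith

/-- The expected reward at time `t`. -/
def expReward (π : HPolicy D A) (t : ℕ) : ℝ :=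
  ∫ h, ∫ a, M.R h.last a ∂(π.act t h) ∂(M.histLaw π t)

lemma reward_mem (π : HPolicy D A) (t : ℕ) (h : Hist D t) :
    ∫ a, M.R h.last a ∂(π.act t h) ∈ Set.Icc (0 : ℝ) 1 :=
  integral_mem_Icc (M.measurable_R.comp measurable_prodMk_left) fun _ ↦ M.R_mem _ _

lemma hasSum_value (π : HPolicy D A) :
    HasSum (fun t ↦ M.γ ^ t * M.expReward π t) (M.value π) := by
  have hmeas : ∀ t, Measurable fun s : ℕ → State D ↦
      ∫ a, M.R (s t) a ∂(π.act t (Preorder.frestrictLe (π := fun _ ↦ State D) t s)) := fun t ↦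
    (M.measurable_reward π t).comp (Preorder.measurable_frestrictLe t)
  have h01 : ∀ t (s : ℕ → State D),
      ∫ a, M.R (s t) a ∂(π.act t (Preorder.frestrictLe (π := fun _ ↦ State D) t s))
        ∈ Set.Icc (0 : ℝ) 1 := fun t s ↦
    M.reward_mem π t (Preorder.frestrictLe (π := fun _ ↦ State D) t s)
  have key := hasSum_integral_of_summable_integral_norm (μ := M.traj π)
    (F := fun (t : ℕ) (s : ℕ → State D) ↦ M.γ ^ t *
      ∫ a, M.R (s t) a ∂(π.act t (Preorder.frestrictLe (π := fun _ ↦ State D) t s)))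
    (fun t ↦ (integrable_of_mem_Icc (hmeas t) (h01 t)).const_mul _) ?_
  · rw [show (fun t ↦ M.γ ^ t * M.expReward π t) = _ from funext fun t ↦ ?_]
    · exact key
    rw [integral_const_mul, expReward, histLaw, integral_map (by fun_prop)
      (M.measurable_reward π t).aestronglyMeasurable]
    rfl
  · refine Summable.of_nonneg_of_le (fun t ↦ integral_nonneg fun _ ↦ norm_nonneg _) (fun t ↦ ?_)
      (summable_geometric_of_lt_one M.γ_nonneg M.γ_lt_one)
    calc _ ≤ ∫ _, M.γ ^ t ∂(M.traj π) := by
          refine integral_mono ((integrable_of_mem_Icc (hmeas t) (h01 t)).const_mul _).norm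
            (integrable_const _) fun s ↦ ?_
          have := h01 t s
          have hγ := pow_nonneg M.γ_nonneg t
          simp only [norm_mul, Real.norm_eq_abs, abs_of_nonneg hγ, abs_of_nonneg this.1]
          exact mul_le_of_le_one_right hγ this.2
      _ = M.γ ^ t := by simp

/-- At time `t` the history laws have drifted by at most the sum of `e k` over `k < t`, and the
current action adds `e t`. Weighted by `γ ^ t`, these partial sums form the Cauchy product of `γ ^ k
* e k` with the geometric series. Only times of nonzero weight are constrained, since the occupancy
sees no others (when `γ = 0`, only time `0`). -/
lemma abs_value_sub_le (π π' : HPolicy D A) (b : (t : ℕ) → Hist D t → ℝ) (e : ℕ → ℝ) (S : ℝ)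
    (hint : ∀ k, M.γ ^ k ≠ 0 → Integrable (b k) (M.histLaw π k))
    (hb : ∀ k, M.γ ^ k ≠ 0 →
      ∀ᵐ h ∂(M.histLaw π k), ActClose (π.act k h) (π'.act k h) (b k h))
    (he : ∀ k, M.γ ^ k ≠ 0 → ∫ h, b k h ∂(M.histLaw π k) ≤ e k)
    (hS : HasSum (fun k ↦ M.γ ^ k * e k) S) :
    |M.value π - M.value π'| ≤ S / (1 - M.γ) := by
  have hγ0 := M.γ_nonneg
  have hγ1 := M.γ_lt_one
  have hterm : ∀ t, |M.γ ^ t * M.expReward π t - M.γ ^ t * M.expReward π' t|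
      ≤ ∑ k ∈ Finset.range (t + 1), (M.γ ^ k * e k) * M.γ ^ (t - k) := by
    intro t
    have hR : ∑ k ∈ Finset.range (t + 1), (M.γ ^ k * e k) * M.γ ^ (t - k)
        = M.γ ^ t * ∑ k ∈ Finset.range (t + 1), e k := by
      rw [Finset.mul_sum]
      refine Finset.sum_congr rfl fun k hk ↦ ?_
      have : k + (t - k) = t := by have := Finset.mem_range.1 hk; omega
      rw [← this, pow_add, this]; ring
    rw [hR, ← mul_sub, abs_mul, abs_of_nonneg (pow_nonneg hγ0 t)]
    rcases eq_or_ne (M.γ ^ t) 0 with h0 | h0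
    · simp [h0]
    refine mul_le_mul_of_nonneg_left ?_ (pow_nonneg hγ0 t)
    have hk : ∀ k ≤ t, M.γ ^ k ≠ 0 := fun k hk hk0 ↦ h0 (by
      rw [← Nat.sub_add_cancel hk, pow_add, hk0, mul_zero])
    have h1 := M.abs_integral_histLaw_sub_le π π' b t (fun k hkt ↦ hint k (hk k hkt.le))
      (fun k hkt ↦ hb k (hk k hkt.le)) (M.measurable_reward π' t) (M.reward_mem π' t)
    have h2 : |M.expReward π t
        - ∫ h, ∫ a, M.R h.last a ∂(π'.act t h) ∂(M.histLaw π t)| ≤ e t := by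
      refine le_trans ?_ (he t h0)
      have i1 := integrable_of_mem_Icc (ν := M.histLaw π t)
        (M.measurable_reward π t) (M.reward_mem π t)
      have i2 := integrable_of_mem_Icc (ν := M.histLaw π t)
        (M.measurable_reward π' t) (M.reward_mem π' t)
      rw [expReward, ← integral_sub i1 i2]
      refine abs_integral_le_integral_abs.trans (integral_mono_ae (i1.sub i2).abs (hint t h0) ?_)
      filter_upwards [hb t h0] with h hh
      exact hh _ (M.measurable_R.comp measurable_prodMk_left) fun _ ↦ M.R_mem _ _
    have h3 : ∑ k ∈ Finset.range t, ∫ h, b k h ∂(M.histLaw π k) ≤ ∑ k ∈ Finset.range t, e k :=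
      Finset.sum_le_sum fun k hkt ↦ he k (hk k (Finset.mem_range.1 hkt).le)
    rw [Finset.sum_range_succ]
    calc _ ≤ _ := abs_sub_le _ (∫ h, ∫ a, M.R h.last a ∂(π'.act t h) ∂(M.histLaw π t)) _
      _ ≤ _ := by rw [add_comm]; exact add_le_add (h1.trans h3) h2
  have hgeo := hasSum_geometric_of_lt_one hγ0 hγ1
  have hcauchy := hasSum_sum_range_mul_of_summable_norm (f := fun k ↦ M.γ ^ k * e k)
    (g := fun k ↦ M.γ ^ k) hS.summable.norm hgeo.summable.norm
  rw [hS.tsum_eq, hgeo.tsum_eq, ← div_eq_mul_inv] at hcauchy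
  have hd := (M.hasSum_value π).sub (M.hasSum_value π')
  rw [← hd.tsum_eq, ← hcauchy.tsum_eq]
  have hs : Summable fun t ↦ |M.γ ^ t * M.expReward π t - M.γ ^ t * M.expReward π' t| :=
    Summable.of_nonneg_of_le (fun _ ↦ abs_nonneg _) hterm hcauchy.summable
  refine (norm_tsum_le_tsum_norm (f := fun t ↦
    M.γ ^ t * M.expReward π t - M.γ ^ t * M.expReward π' t) hs).trans ?_
  exact hs.tsum_le_tsum hterm hcauchy.summable

end MDP

end

/-! ### Occupancy distributions and the two value comparisons. -/

section

variable {D : ℕ} {A : Type*} [MeasurableSpace A]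

namespace MDP

variable (M : MDP D A)

/-- The law of the state `s_t` under the policy `π`. -/
def stateLaw (π : HPolicy D A) (t : ℕ) : Measure (State D) :=
  (M.traj π).map (fun s ↦ s t)

instance (π : HPolicy D A) (t : ℕ) : IsProbabilityMeasure (M.stateLaw π t) :=
  Measure.isProbabilityMeasure_map (measurable_pi_apply t).aemeasurable

lemma map_last_histLaw (π : HPolicy D A) (t : ℕ) :
    (M.histLaw π t).map Hist.last = M.stateLaw π t := by
  rw [histLaw, stateLaw, Measure.map_map Hist.measurable_last (by fun_prop)]
  rfl

lemma occupancy_eq (π : HPolicy D A) : M.occupancy π = ENNReal.ofReal (1 - M.γ) •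
    Measure.sum fun t : ℕ ↦ ENNReal.ofReal (M.γ ^ t) • M.stateLaw π t := rfl

lemma occupancy_apply (π : HPolicy D A) {s : Set (State D)} (hs : MeasurableSet s) :
    M.occupancy π s = ENNReal.ofReal (1 - M.γ) *
      ∑' t, ENNReal.ofReal (M.γ ^ t) * M.stateLaw π t s := by
  simp [occupancy_eq, Measure.sum_apply _ hs]

instance (π : HPolicy D A) : IsProbabilityMeasure (M.occupancy π) := by
  refine ⟨?_⟩
  have h0 : 0 < 1 - M.γ := sub_pos.2 M.γ_lt_one
  rw [occupancy_apply _ _ .univ]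
  simp only [measure_univ, mul_one]
  rw [← ENNReal.ofReal_tsum_of_nonneg (fun t ↦ pow_nonneg M.γ_nonneg t)
    (summable_geometric_of_lt_one M.γ_nonneg M.γ_lt_one),
    tsum_geometric_of_lt_one M.γ_nonneg M.γ_lt_one, ← ENNReal.ofReal_mul h0.le,
    mul_inv_cancel₀ h0.ne', ENNReal.ofReal_one]

/-- The occupancy dominates each of its summands; almost sure statements and integrability thus pass
to every time of nonzero weight. -/
lemma smul_stateLaw_le_occupancy (π : HPolicy D A) (t : ℕ) :
    ENNReal.ofReal ((1 - M.γ) * M.γ ^ t) • M.stateLaw π t ≤ M.occupancy π := by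
  refine Measure.le_iff.2 fun s hs ↦ ?_
  rw [occupancy_apply _ _ hs, ENNReal.ofReal_mul (sub_nonneg.2 M.γ_lt_one.le)]
  simp only [Measure.smul_apply, smul_eq_mul, mul_assoc]
  gcongr
  exact ENNReal.le_tsum (f := fun t ↦ ENNReal.ofReal (M.γ ^ t) * M.stateLaw π t s) t

lemma ofReal_weight_ne_zero {t : ℕ} (ht : M.γ ^ t ≠ 0) :
    ENNReal.ofReal ((1 - M.γ) * M.γ ^ t) ≠ 0 := by
  simpa using mul_pos (sub_pos.2 M.γ_lt_one)
    (lt_of_le_of_ne (pow_nonneg M.γ_nonneg t) ht.symm)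

lemma stateLaw_absolutelyContinuous (π : HPolicy D A) {t : ℕ} (ht : M.γ ^ t ≠ 0) :
    M.stateLaw π t ≪ M.occupancy π := by
  refine .trans ?_ (M.smul_stateLaw_le_occupancy π t).absolutelyContinuous
  exact Measure.absolutelyContinuous_smul (M.ofReal_weight_ne_zero ht)

lemma ae_histLaw_of_ae_occupancy (π : HPolicy D A) {t : ℕ} (ht : M.γ ^ t ≠ 0)
    {p : State D → Prop} (hp : ∀ᵐ s ∂(M.occupancy π), p s) :
    ∀ᵐ h ∂(M.histLaw π t), p h.last := by
  have h1 : ∀ᵐ s ∂(M.stateLaw π t), p s := (M.stateLaw_absolutelyContinuous π ht).ae_le hp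
  rw [← map_last_histLaw] at h1
  exact ae_of_ae_map Hist.measurable_last.aemeasurable h1

lemma integrable_stateLaw (π : HPolicy D A) {t : ℕ} (ht : M.γ ^ t ≠ 0)
    {g : State D → ℝ} (hg : Integrable g (M.occupancy π)) : Integrable g (M.stateLaw π t) :=
  (integrable_smul_measure (M.ofReal_weight_ne_zero ht) ENNReal.ofReal_ne_top).1
    (hg.mono_measure (M.smul_stateLaw_le_occupancy π t))

lemma hasSum_integral_stateLaw (π : HPolicy D A) {g : State D → ℝ}
    (hg : Integrable g (M.occupancy π)) :
    HasSum (fun t ↦ M.γ ^ t * ∫ s, g s ∂(M.stateLaw π t))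
      ((∫ s, g s ∂(M.occupancy π)) / (1 - M.γ)) := by
  have h0 : 0 < 1 - M.γ := sub_pos.2 M.γ_lt_one
  have hg' := (integrable_smul_measure (by simpa using h0) ENNReal.ofReal_ne_top).1
    (M.occupancy_eq π ▸ hg)
  have h1 := hasSum_integral_measure hg'
  rw [occupancy_eq, integral_smul_measure, ENNReal.toReal_ofReal h0.le, smul_eq_mul,
    mul_div_cancel_left₀ _ h0.ne']
  simpa [integral_smul_measure, ENNReal.toReal_ofReal (pow_nonneg M.γ_nonneg _)] using h1

/-- Policies that agree almost everywhere under the occupancy distribution of one of them have the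
same state laws at all times that the discount factor does not ignore. -/
lemma stateLaw_congr (π π' : Policy D A)
    (h : ∀ᵐ s ∂(M.occupancy π.toHPolicy), π'.act s = π.act s) {t : ℕ} (h0 : M.γ ^ t ≠ 0) :
    M.stateLaw π'.toHPolicy t = M.stateLaw π.toHPolicy t := by
  refine Measure.ext fun S hS ↦ ?_
  have hk : ∀ k < t, M.γ ^ k ≠ 0 := fun k hk hk0 ↦ h0 (by
    rw [← Nat.sub_add_cancel hk.le, pow_add, hk0, mul_zero])
  have hS' : MeasurableSet (Hist.last (t := t) ⁻¹' S) := Hist.measurable_last hS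
  have hb : ∀ k < t, ∀ᵐ x ∂(M.histLaw π.toHPolicy k),
      ActClose (π.toHPolicy.act k x) (π'.toHPolicy.act k x) 0 := fun k hkt ↦ by
    filter_upwards [M.ae_histLaw_of_ae_occupancy π.toHPolicy (hk k hkt) h] with x hx φ _ _
    simp [Policy.toHPolicy, Kernel.comap_apply, hx]
  -- The hybrid bound with zero error, tested on indicators.
  have key := M.abs_integral_histLaw_sub_le π.toHPolicy π'.toHPolicy (fun _ _ ↦ 0) t
    (fun _ _ ↦ integrable_zero _ _ _) hb
    (g := (Hist.last ⁻¹' S).indicator fun _ ↦ (1 : ℝ))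
    (measurable_const.indicator hS')
    (fun x ↦ by by_cases hx : x ∈ Hist.last ⁻¹' S <;> simp [hx])
  rw [integral_indicator_const _ hS', integral_indicator_const _ hS'] at key
  simp only [integral_zero, Finset.sum_const_zero, abs_nonpos_iff, sub_eq_zero, smul_eq_mul,
    mul_one] at key
  rw [← map_last_histLaw, ← map_last_histLaw, Measure.map_apply Hist.measurable_last hS,
    Measure.map_apply Hist.measurable_last hS]
  exact ((measureReal_eq_measureReal_iff).1 key).symm

lemma occupancy_congr (π π' : Policy D A)
    (h : ∀ᵐ s ∂(M.occupancy π.toHPolicy), π'.act s = π.act s) :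
    M.occupancy π'.toHPolicy = M.occupancy π.toHPolicy := by
  have key : ∀ t, ENNReal.ofReal (M.γ ^ t) • M.stateLaw π'.toHPolicy t
      = ENNReal.ofReal (M.γ ^ t) • M.stateLaw π.toHPolicy t := fun t ↦ by
    rcases eq_or_ne (M.γ ^ t) 0 with h0 | h0
    · rw [h0, ENNReal.ofReal_zero, zero_smul, zero_smul]
    · rw [M.stateLaw_congr π π' h h0]
  rw [occupancy_eq, occupancy_eq, funext key]

end MDP

lemma integrable_vec_of_integrable_norm {ν : Measure (State D)}
    (h : Integrable (fun s ↦ ‖s‖) ν) : Integrable (fun s : State D ↦ s) ν :=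
  (integrable_norm_iff (by fun_prop)).1 h

lemma Policy.IsLipschitz.nonneg {π : Policy D A} {L : ℝ} (h : π.IsLipschitz L) (hD : 0 < D) :
    0 ≤ L := by
  have := (tsum_nonneg fun _ ↦ abs_nonneg _).trans
    (h (EuclideanSpace.single ⟨0, hD⟩ (1 : ℝ)) 0)
  simpa using this

lemma triggered_precomp_eq (π : Policy D A) (f : Trigger D) (T : State D →L[ℝ] State D)
    (hT : ∀ t h, T (f.fn t h) = 0) : (π.precomp T).triggered f = (π.precomp T).toHPolicy := by
  have : ∀ t, ((π.precomp T).triggered f).act t = ((π.precomp T).toHPolicy).act t := fun t ↦ by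
    ext1 h
    simp [Policy.triggered, Policy.toHPolicy, Policy.precomp, Kernel.comap_apply,
      Trigger.perceived, hT]
  have h2 := funext this
  -- The other field of `HPolicy` is a proof, so equality of `act` suffices.
  generalize (π.precomp T).triggered f = x at *
  generalize (π.precomp T).toHPolicy = y at *
  cases x; cases y; cases h2; rfl

variable [Countable A] [DiscreteMeasurableSpace A]

/-- On a countable discrete space integrals are sums over atoms, and the weights `φ a` are at most
`1`. -/
lemma actClose_tsum (p q : Measure A) [IsProbabilityMeasure p] [IsProbabilityMeasure q] :
    ActClose p q (∑' a, |p.real {a} - q.real {a}|) := by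
  intro φ hφ h01
  have hs : ∀ (r : Measure A) [IsProbabilityMeasure r],
      HasSum (fun a ↦ r.real {a} * φ a) (∫ a, φ a ∂r) := fun r _ ↦ by
    have := hasSum_integral_iUnion (μ := r) (f := φ) (s := fun a : A ↦ {a})
      (fun _ ↦ .singleton _) (fun _ _ hab ↦ by simpa using hab)
      (MDP.integrable_of_mem_Icc hφ h01).integrableOn
    simpa [Set.iUnion_of_singleton, measureReal_def] using this
  have hsum : ∀ (r : Measure A) [IsProbabilityMeasure r], Summable fun a ↦ r.real {a} :=
    fun r _ ↦ by
    have := hasSum_integral_iUnion (μ := r) (f := fun _ ↦ (1 : ℝ)) (s := fun a : A ↦ {a})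
      (fun _ ↦ .singleton _) (fun _ _ hab ↦ by simpa using hab)
      (integrable_const _).integrableOn
    simpa [measureReal_def] using this.summable
  have habs : Summable fun a ↦ |p.real {a} - q.real {a}| := ((hsum p).sub (hsum q)).abs
  have hterm : ∀ a, |p.real {a} * φ a - q.real {a} * φ a| ≤ |p.real {a} - q.real {a}| := by
    intro a
    rw [← sub_mul, abs_mul, abs_of_nonneg (h01 a).1]
    exact mul_le_of_le_one_right (abs_nonneg _) (h01 a).2
  have hs' : Summable fun a ↦ |p.real {a} * φ a - q.real {a} * φ a| :=
    Summable.of_nonneg_of_le (fun _ ↦ abs_nonneg _) hterm habs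
  rw [← ((hs p).sub (hs q)).tsum_eq]
  exact (norm_tsum_le_tsum_norm (f := fun a ↦ p.real {a} * φ a - q.real {a} * φ a) hs').trans
    (hs'.tsum_le_tsum hterm habs)

lemma Policy.IsLipschitz.actClose {π : Policy D A} {L : ℝ} (h : π.IsLipschitz L) (x y : State D) :
    ActClose (π.act x) (π.act y) (L * ‖x - y‖) := fun φ hφ h01 ↦
  (actClose_tsum _ _ φ hφ h01).trans (h x y)

namespace MDP

variable (M : MDP D A)

/-- With `π` as reference only states of its occupancy matter, and there `π'` may replace `π` before
the Lipschitz bound is applied. One factor `1 / (1 - γ)` comes from normalizing the occupancy, the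
other from the drift of the history laws. -/
lemma abs_value_sub_precomp_le {π π' : Policy D A} {L : ℝ} (hL : π'.IsLipschitz L)
    (hagree : ∀ᵐ s ∂(M.occupancy π.toHPolicy), π'.act s = π.act s)
    (hint : Integrable (fun s ↦ ‖s‖) (M.occupancy π.toHPolicy))
    (T : State D →L[ℝ] State D) :
    |M.value π.toHPolicy - M.value (π'.precomp T).toHPolicy|
      ≤ L / (1 - M.γ) ^ 2 * ∫ s, ‖s - T s‖ ∂(M.occupancy π.toHPolicy) := by
  have hid := integrable_vec_of_integrable_norm hint
  have hi : Integrable (fun s ↦ L * ‖s - T s‖) (M.occupancy π.toHPolicy) :=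
    (hid.sub (T.integrable_comp hid)).norm.const_mul _
  have hmap : ∀ k, ∫ h : Hist D k, L * ‖h.last - T h.last‖ ∂(M.histLaw π.toHPolicy k)
      = ∫ s, L * ‖s - T s‖ ∂(M.stateLaw π.toHPolicy k) := fun k ↦ by
    rw [← map_last_histLaw, integral_map Hist.measurable_last.aemeasurable
      (f := fun s ↦ L * ‖s - T s‖) (by fun_prop)]
  have h0 : 0 < 1 - M.γ := sub_pos.2 M.γ_lt_one
  refine (M.abs_value_sub_le π.toHPolicy (π'.precomp T).toHPolicy
    (fun _ h ↦ L * ‖h.last - T h.last‖) _ _ (fun k hk ↦ ?_) (fun k hk ↦ ?_)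
    (fun k _ ↦ (hmap k).le) (M.hasSum_integral_stateLaw _ hi)).trans (le_of_eq ?_)
  · have := M.integrable_stateLaw π.toHPolicy hk hi
    rw [← map_last_histLaw] at this
    exact this.comp_measurable Hist.measurable_last
  · filter_upwards [M.ae_histLaw_of_ae_occupancy π.toHPolicy hk hagree] with h hh
    have := hL.actClose h.last (T h.last)
    rw [hh] at this
    simpa [Policy.toHPolicy, Policy.precomp, Kernel.comap_apply] using this
  · rw [integral_const_mul]
    field_simp

/-- The perceived states are averaged under the sanitized policy `π.precomp T`, which is why their
bound is needed for all stationary policies. -/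
lemma abs_value_triggered_precomp_sub_le {π : Policy D A} {L : ℝ} (hL : π.IsLipschitz L)
    (hL0 : 0 ≤ L) {f : Trigger D} {B : ℝ} (hB : f.IsBoundedInExpectation M B)
    (T T' : State D →L[ℝ] State D) :
    |M.value ((π.precomp T).triggered f) - M.value ((π.precomp T').triggered f)|
      ≤ L * B * ‖T - T'‖ / (1 - M.γ) ^ 2 := by
  have h0 : 0 < 1 - M.γ := sub_pos.2 M.γ_lt_one
  set ρ := (π.precomp T).triggered f with hρ
  have hi : ∀ k, Integrable (fun h ↦ f.perceived k h) (M.histLaw ρ k) := fun k ↦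
    (integrable_map_measure (f.measurable_perceived k).aestronglyMeasurable (by fun_prop)).2
      (hB (π.precomp T) k).1
  have hBk : ∀ k, ∫ h, ‖f.perceived k h‖ ∂(M.histLaw ρ k) ≤ B := fun k ↦ by
    rw [histLaw, integral_map (by fun_prop)
      (f.measurable_perceived k).norm.aestronglyMeasurable]
    exact (hB (π.precomp T) k).2
  have hS := (hasSum_geometric_of_lt_one M.γ_nonneg M.γ_lt_one).mul_right (L * B * ‖T - T'‖)
  refine (M.abs_value_sub_le ρ ((π.precomp T').triggered f)
    (fun k h ↦ L * ‖T (f.perceived k h) - T' (f.perceived k h)‖) _ _ (fun k _ ↦ ?_)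
    (fun k _ ↦ .of_forall fun h ↦ ?_) (fun k _ ↦ ?_) hS).trans (le_of_eq ?_)
  · exact ((T.integrable_comp (hi k)).sub (T'.integrable_comp (hi k))).norm.const_mul _
  · simpa [hρ, Policy.triggered, Policy.precomp, Kernel.comap_apply] using
      hL.actClose (T (f.perceived k h)) (T' (f.perceived k h))
  · calc _ ≤ ∫ h, L * ‖T - T'‖ * ‖f.perceived k h‖ ∂(M.histLaw ρ k) := by
          refine integral_mono
            (((T.integrable_comp (hi k)).sub (T'.integrable_comp (hi k))).norm.const_mul _)
            ((hi k).norm.const_mul _) fun h ↦ ?_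
          dsimp only
          rw [mul_assoc]
          exact mul_le_mul_of_nonneg_left ((T - T').le_opNorm _) hL0
      _ ≤ L * ‖T - T'‖ * B := by
          rw [integral_const_mul]
          exact mul_le_mul_of_nonneg_left (hBk k) (by positivity)
      _ = _ := by ring
  · field_simp

end MDP

end

/-! ### Perturbation of eigenspaces, and operator norms via nets. -/

section

variable {D : ℕ}

/-- The operator on Euclidean space given by a square matrix. -/
abbrev toOp (S : Matrix (Fin D) (Fin D) ℝ) : State D →L[ℝ] State D :=
  Matrix.toEuclideanCLM (n := Fin D) (𝕜 := ℝ) S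

lemma inner_toOp (S : Matrix (Fin D) (Fin D) ℝ) (x y : State D) :
    inner ℝ x (toOp S y) = ∑ i, ∑ j, S i j * (x i * y j) := by
  rw [Matrix.inner_toEuclideanCLM]
  simp only [dotProduct, Matrix.mulVec, Finset.mul_sum]
  exact Finset.sum_congr rfl fun i _ ↦ Finset.sum_congr rfl fun j _ ↦ by ring

lemma inner_eq_sum (x y : State D) : inner ℝ x y = ∑ i, x i * y i := by
  simp [PiLp.inner_apply, mul_comm]

lemma inner_toOp_vecMulVec (w x y : State D) :
    inner ℝ x (toOp (Matrix.vecMulVec w w) y) = inner ℝ w x * inner ℝ w y := by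
  rw [inner_toOp, inner_eq_sum, inner_eq_sum, Finset.sum_mul_sum]
  exact Finset.sum_congr rfl fun i _ ↦ Finset.sum_congr rfl fun j _ ↦ by
    rw [Matrix.vecMulVec_apply]; ring

namespace IsEigenDecomp

variable {S : Matrix (Fin D) (Fin D) ℝ} {u : OrthonormalBasis (Fin D) ℝ (State D)}
  {lam : Fin D → ℝ}

lemma inner_toOp (h : IsEigenDecomp S u lam) (x y : State D) :
    inner ℝ x (toOp S y) = ∑ i, lam i * (inner ℝ (u i) x * inner ℝ (u i) y) := by
  rw [toOp, h.eq_sum, map_sum, sum_apply, inner_sum]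
  refine Finset.sum_congr rfl fun i _ ↦ ?_
  rw [map_smul, smul_apply, inner_smul_right]
  exact congrArg _ (inner_toOp_vecMulVec _ _ _)

lemma inner_basis (h : IsEigenDecomp S u lam) (i : Fin D) :
    inner ℝ (u i) (toOp S (u i)) = lam i := by
  rw [h.inner_toOp, Finset.sum_eq_single i]
  · simp
  · intro j _ hj; simp [u.inner_eq_zero hj]
  · simp

lemma symm (h : IsEigenDecomp S u lam) (x y : State D) :
    inner ℝ x (toOp S y) = inner ℝ (toOp S x) y := by
  rw [real_inner_comm y (toOp S x), h.inner_toOp, h.inner_toOp]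
  exact Finset.sum_congr rfl fun i _ ↦ by ring

end IsEigenDecomp

/-- The indices of the first `d` coordinates. -/
abbrev topIdx (D d : ℕ) : Finset (Fin D) := Finset.univ.filter fun i ↦ (i : ℕ) < d

lemma card_topIdx_le (D d : ℕ) : (topIdx D d).card ≤ d := by
  calc (topIdx D d).card = ((topIdx D d).map Fin.valEmbedding).card := (Finset.card_map _).symm
    _ ≤ (Finset.range d).card := Finset.card_le_card fun x hx ↦ by
        simp only [Finset.mem_map, Finset.mem_filter] at hx
        obtain ⟨i, hi, rfl⟩ := hx
        exact Finset.mem_range.2 hi.2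
    _ = d := Finset.card_range d

section Projections

variable (u v : OrthonormalBasis (Fin D) ℝ (State D)) (d : ℕ)

lemma topProj_basis_of_lt {i : Fin D} (hi : (i : ℕ) < d) : topProj u d (u i) = u i :=
  Submodule.starProjection_eq_self_iff.2 (Submodule.subset_span ⟨i, hi, rfl⟩)

lemma topProj_eq_zero_of_mem_botSpace {x : State D} (hx : x ∈ botSpace u d) :
    topProj u d x = 0 := by
  refine (Submodule.starProjection_apply_eq_zero_iff (topSpace u d)).2 ?_
  have : botSpace u d ≤ (topSpace u d)ᗮ := by
    refine Submodule.isOrtho_iff_le.1 (Submodule.isOrtho_span.2 ?_)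
    rintro _ ⟨i, hi, rfl⟩ _ ⟨j, hj, rfl⟩
    refine u.inner_eq_zero fun h ↦ ?_
    subst h
    exact (not_lt.2 (show d ≤ (i : ℕ) from hi)) hj
  exact this hx

lemma topProj_basis_of_le {i : Fin D} (hi : d ≤ (i : ℕ)) : topProj u d (u i) = 0 :=
  topProj_eq_zero_of_mem_botSpace u d (Submodule.subset_span ⟨i, hi, rfl⟩)

lemma topProj_symm (x y : State D) :
    inner ℝ (topProj u d x) y = inner ℝ x (topProj u d y) :=
  Submodule.starProjection_isSymmetric (topSpace u d) x y

lemma inner_basis_topProj (i : Fin D) (x : State D) :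
    inner ℝ (u i) (topProj u d x) = if (i : ℕ) < d then inner ℝ (u i) x else 0 := by
  rw [← topProj_symm]
  split_ifs with h
  · rw [topProj_basis_of_lt u d h]
  · rw [topProj_basis_of_le u d (not_lt.1 h), inner_zero_left]

lemma norm_sq_eq_sum_inner (x : State D) : ‖x‖ ^ 2 = ∑ i, inner ℝ (u i) x ^ 2 := by
  rw [← u.sum_sq_norm_inner_right x]
  simp

lemma norm_topProj_sq (x : State D) :
    ‖topProj u d x‖ ^ 2 = ∑ i ∈ topIdx D d, inner ℝ (u i) x ^ 2 := by
  rw [norm_sq_eq_sum_inner u, Finset.sum_filter]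
  exact Finset.sum_congr rfl fun i _ ↦ by rw [inner_basis_topProj]; split_ifs <;> simp

lemma norm_sub_topProj_sq (x : State D) :
    ‖x - topProj u d x‖ ^ 2 = ∑ i ∈ (topIdx D d)ᶜ, inner ℝ (u i) x ^ 2 := by
  rw [norm_sq_eq_sum_inner u, Finset.compl_filter, Finset.sum_filter]
  exact Finset.sum_congr rfl fun i _ ↦ by
    rw [inner_sub_right, inner_basis_topProj]; split_ifs <;> simp

/-- The squared sine distance between the top spaces of two orthonormal bases. -/
def sinSq : ℝ := ∑ i ∈ topIdx D d, ∑ j ∈ (topIdx D d)ᶜ, inner ℝ (u i) (v j) ^ 2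

lemma sum_inner_sq_right (i : Fin D) : ∑ j, inner ℝ (u i) (v j) ^ 2 = 1 := by
  have := norm_sq_eq_sum_inner v (u i)
  simp only [u.norm_eq_one, one_pow] at this
  rw [this]
  exact Finset.sum_congr rfl fun j _ ↦ by rw [real_inner_comm]

lemma sum_inner_sq_left (j : Fin D) : ∑ i, inner ℝ (u i) (v j) ^ 2 = 1 := by
  have := norm_sq_eq_sum_inner u (v j)
  simpa using this.symm

lemma sinSq_nonneg : 0 ≤ sinSq u v d :=
  Finset.sum_nonneg fun _ _ ↦ Finset.sum_nonneg fun _ _ ↦ sq_nonneg _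

/-- The matrix of squared inner products is doubly stochastic, so its two off-diagonal blocks have
equal mass. -/
lemma sinSq_eq : sinSq u v d =
    ∑ i ∈ (topIdx D d)ᶜ, ∑ j ∈ topIdx D d, inner ℝ (u i) (v j) ^ 2 := by
  have h1 : ∑ i ∈ topIdx D d, ∑ j, inner ℝ (u i) (v j) ^ 2 = (topIdx D d).card := by
    simp [sum_inner_sq_right]
  have h2 : ∑ j ∈ topIdx D d, ∑ i, inner ℝ (u i) (v j) ^ 2 = (topIdx D d).card := by
    simp [sum_inner_sq_left]
  simp_rw [← Finset.sum_add_sum_compl (topIdx D d), Finset.sum_add_distrib] at h1 h2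
  rw [Finset.sum_comm] at h2
  rw [sinSq, Finset.sum_comm (s := (topIdx D d)ᶜ)]
  linarith

/-- The right side is the squared Hilbert–Schmidt norm of the difference, each off-diagonal block
contributing one `sinSq`. -/
lemma norm_topProj_sub_sq_le : ‖topProj u d - topProj v d‖ ^ 2 ≤ 2 * sinSq u v d := by
  have hsum : ∑ i, ‖topProj u d (u i) - topProj v d (u i)‖ ^ 2 = 2 * sinSq u v d := by
    rw [← Finset.sum_add_sum_compl (topIdx D d), two_mul]
    congr 1
    · refine Finset.sum_congr rfl fun i hi ↦ ?_
      rw [topProj_basis_of_lt u d (by simpa using hi), norm_sub_topProj_sq]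
      exact Finset.sum_congr rfl fun j _ ↦ by rw [real_inner_comm]
    · rw [sinSq_eq]
      refine Finset.sum_congr rfl fun i hi ↦ ?_
      rw [topProj_basis_of_le u d (by simpa using hi), zero_sub, norm_neg, norm_topProj_sq]
      exact Finset.sum_congr rfl fun j _ ↦ by rw [real_inner_comm]
  have h2 : 0 ≤ 2 * sinSq u v d := by have := sinSq_nonneg u v d; positivity
  rw [← Real.sq_sqrt h2]
  refine pow_le_pow_left₀ (norm_nonneg _) ?_ 2
  refine ContinuousLinearMap.opNorm_le_bound _ (Real.sqrt_nonneg _) fun x ↦ ?_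
  refine le_of_sq_le_sq ?_ (by positivity)
  rw [mul_pow, Real.sq_sqrt h2, norm_sq_eq_sum_inner u, ← hsum, Finset.sum_mul]
  refine Finset.sum_le_sum fun i _ ↦ ?_
  rw [← mul_pow, sub_apply, inner_sub_right, ← topProj_symm, ← topProj_symm,
    ← inner_sub_left, ← sq_abs]
  exact pow_le_pow_left₀ (abs_nonneg _) (abs_real_inner_le_norm _ _) 2

variable {u v d} {S S' : Matrix (Fin D) (Fin D) ℝ} {lam mu : Fin D → ℝ}

/-- A quantitative Ky Fan principle: passing from the top space of `u` to that of `v` moves mass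
`sinSq` from eigenvalues at least `lam p` to eigenvalues at most `lam q`. -/
lemma IsEigenDecomp.gap_mul_sinSq_le (h : IsEigenDecomp S u lam)
    (v : OrthonormalBasis (Fin D) ℝ (State D))
    {p q : Fin D} (hp : (p : ℕ) + 1 = d) (hq : (q : ℕ) = d) :
    (lam p - lam q) * sinSq u v d
      ≤ ∑ i ∈ topIdx D d, inner ℝ (u i) (toOp S (u i))
        - ∑ j ∈ topIdx D d, inner ℝ (v j) (toOp S (v j)) := by
  have e1 : ∑ j ∈ topIdx D d, inner ℝ (v j) (toOp S (v j))
      = ∑ i, lam i * ∑ j ∈ topIdx D d, inner ℝ (u i) (v j) ^ 2 := by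
    simp_rw [h.inner_toOp, Finset.mul_sum]
    rw [Finset.sum_comm]
    exact Finset.sum_congr rfl fun i _ ↦ Finset.sum_congr rfl fun j _ ↦ by ring
  have e2 : ∀ i, ∑ j ∈ (topIdx D d)ᶜ, inner ℝ (u i) (v j) ^ 2
      = 1 - ∑ j ∈ topIdx D d, inner ℝ (u i) (v j) ^ 2 := fun i ↦ by
    rw [← sum_inner_sq_right u v i, ← Finset.sum_add_sum_compl (topIdx D d)]; ring
  have e3 : ∑ i ∈ topIdx D d, inner ℝ (u i) (toOp S (u i))
        - ∑ j ∈ topIdx D d, inner ℝ (v j) (toOp S (v j))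
      = ∑ i ∈ topIdx D d, lam i * ∑ j ∈ (topIdx D d)ᶜ, inner ℝ (u i) (v j) ^ 2
        - ∑ i ∈ (topIdx D d)ᶜ, lam i * ∑ j ∈ topIdx D d, inner ℝ (u i) (v j) ^ 2 := by
    rw [e1, ← Finset.sum_add_sum_compl (topIdx D d) (fun i ↦ lam i * _)]
    simp_rw [h.inner_basis, e2, mul_sub, mul_one, Finset.sum_sub_distrib]
    ring
  have i1 : lam p * sinSq u v d
      ≤ ∑ i ∈ topIdx D d, lam i * ∑ j ∈ (topIdx D d)ᶜ, inner ℝ (u i) (v j) ^ 2 := by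
    rw [sinSq, Finset.mul_sum]
    refine Finset.sum_le_sum fun i hi ↦ mul_le_mul_of_nonneg_right (h.antitone ?_)
      (Finset.sum_nonneg fun _ _ ↦ sq_nonneg _)
    have : (i : ℕ) < d := by simpa using hi
    exact Fin.le_def.2 (by omega)
  have i2 : ∑ i ∈ (topIdx D d)ᶜ, lam i * ∑ j ∈ topIdx D d, inner ℝ (u i) (v j) ^ 2
      ≤ lam q * sinSq u v d := by
    rw [sinSq_eq, Finset.mul_sum]
    refine Finset.sum_le_sum fun i hi ↦ mul_le_mul_of_nonneg_right (h.antitone ?_)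
      (Finset.sum_nonneg fun _ _ ↦ sq_nonneg _)
    have : d ≤ (i : ℕ) := by simpa using hi
    exact Fin.le_def.2 (by omega)
  rw [e3, sub_mul]
  linarith

/-- Davis–Kahan bound for the top eigenspaces of two symmetric matrices. -/
lemma IsEigenDecomp.gap_sq_mul_sinSq_le (h : IsEigenDecomp S u lam) (h' : IsEigenDecomp S' v mu)
    {p q : Fin D} (hp : (p : ℕ) + 1 = d) (hq : (q : ℕ) = d) (hgap : 0 < lam p - lam q) :
    (lam p - lam q) ^ 2 * sinSq u v d
      ≤ 4 * d * ‖toOp S - toOp S'‖ ^ 2 := by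
  set gap := lam p - lam q with hgapdef
  set τ := sinSq u v d with hτ
  have hτ0 : 0 ≤ τ := sinSq_nonneg u v d
  set Δ := toOp S - toOp S' with hΔ
  set I := topIdx D d
  have hsymm : ∀ x y, inner ℝ x (Δ y) = inner ℝ (Δ x) y := fun x y ↦ by
    rw [hΔ, sub_apply, sub_apply, inner_sub_left,
      inner_sub_right, h.symm, h'.symm]
  have g1 := h.gap_mul_sinSq_le v hp hq
  have g2 := h'.gap_mul_sinSq_le u hp hq
  -- No gap is needed for `S'`: it is enough that its own top space maximizes the trace.
  have g3 : 0 ≤ (mu p - mu q) * sinSq v u d :=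
    mul_nonneg (sub_nonneg.2 (h'.antitone (Fin.le_def.2 (by omega))))
      (sinSq_nonneg _ _ _)
  have hdiff : gap * τ ≤ ∑ i ∈ I, inner ℝ (u i) (Δ (u i)) - ∑ j ∈ I, inner ℝ (v j) (Δ (v j)) := by
    simp only [hΔ, sub_apply, inner_sub_right, Finset.sum_sub_distrib]
    linarith
  -- Expanding both traces in the two bases, the `I × I` block cancels. In each remaining block the
  -- second factors have total square `τ`, so Cauchy–Schwarz gains a factor `√τ`.
  set X := ∑ p ∈ I ×ˢ Iᶜ, inner ℝ (Δ (u p.1)) (v p.2) * inner ℝ (u p.1) (v p.2) with hX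
  set Y := ∑ p ∈ Iᶜ ×ˢ I, inner ℝ (Δ (u p.1)) (v p.2) * inner ℝ (u p.1) (v p.2) with hY
  have hXY : ∑ i ∈ I, inner ℝ (u i) (Δ (u i)) - ∑ j ∈ I, inner ℝ (v j) (Δ (v j)) = X - Y := by
    have a1 : ∀ i, inner ℝ (u i) (Δ (u i))
        = ∑ j, inner ℝ (Δ (u i)) (v j) * inner ℝ (u i) (v j) := fun i ↦ by
      rw [hsymm, ← v.sum_inner_mul_inner (Δ (u i)) (u i)]
      exact Finset.sum_congr rfl fun j _ ↦ by rw [real_inner_comm (v j) (u i)]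
    have a2 : ∀ j, inner ℝ (v j) (Δ (v j))
        = ∑ i, inner ℝ (Δ (u i)) (v j) * inner ℝ (u i) (v j) := fun j ↦ by
      rw [hsymm, ← u.sum_inner_mul_inner (Δ (v j)) (v j)]
      exact Finset.sum_congr rfl fun i _ ↦ by
        rw [← hsymm (u i) (v j), real_inner_comm (u i) (Δ (v j))]
    simp_rw [a1, a2]
    rw [Finset.sum_comm (s := I) (t := Finset.univ) (f := fun j i ↦
      inner ℝ (Δ (u i)) (v j) * inner ℝ (u i) (v j)), hX, hY, Finset.sum_product,
      Finset.sum_product, ← Finset.sum_add_sum_compl I (fun i ↦ ∑ j ∈ I, _)]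
    simp_rw [← Finset.sum_add_sum_compl I (fun j ↦ inner ℝ (Δ (u _)) (v j) * _),
      Finset.sum_add_distrib]
    ring
  have hcard : (I.card : ℝ) ≤ d := by exact_mod_cast card_topIdx_le D d
  have hX2 : X ^ 2 ≤ (d * ‖Δ‖ ^ 2) * τ := by
    refine (Finset.sum_mul_sq_le_sq_mul_sq _ _ _).trans ?_
    rw [Finset.sum_product, Finset.sum_product]
    refine mul_le_mul_of_nonneg_right ?_ hτ0
    calc _ ≤ ∑ i ∈ I, ‖Δ‖ ^ 2 := Finset.sum_le_sum fun i _ ↦ ?_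
      _ ≤ d * ‖Δ‖ ^ 2 := by
        rw [Finset.sum_const, nsmul_eq_mul]
        exact mul_le_mul_of_nonneg_right hcard (sq_nonneg _)
    calc _ ≤ ∑ j, inner ℝ (Δ (u i)) (v j) ^ 2 :=
          Finset.sum_le_sum_of_subset_of_nonneg (Finset.subset_univ _) fun _ _ _ ↦ sq_nonneg _
      _ = ‖Δ (u i)‖ ^ 2 := by
          rw [norm_sq_eq_sum_inner v]
          exact Finset.sum_congr rfl fun j _ ↦ by rw [real_inner_comm]
      _ ≤ ‖Δ‖ ^ 2 := pow_le_pow_left₀ (norm_nonneg _)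
          (by simpa using Δ.le_opNorm (u i)) 2
  have hY2 : Y ^ 2 ≤ (d * ‖Δ‖ ^ 2) * τ := by
    refine (Finset.sum_mul_sq_le_sq_mul_sq _ _ _).trans ?_
    -- The outer sum must run over `I`, which has at most `d` elements; summing over `Iᶜ` first
    -- would cost `D - d`.
    rw [hτ, sinSq_eq, Finset.sum_product_right, Finset.sum_product]
    refine mul_le_mul_of_nonneg_right ?_
      (Finset.sum_nonneg fun _ _ ↦ Finset.sum_nonneg fun _ _ ↦ sq_nonneg _)
    calc _ ≤ ∑ i ∈ I, ‖Δ‖ ^ 2 := Finset.sum_le_sum fun j _ ↦ ?_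
      _ ≤ d * ‖Δ‖ ^ 2 := by
        rw [Finset.sum_const, nsmul_eq_mul]
        exact mul_le_mul_of_nonneg_right hcard (sq_nonneg _)
    calc _ ≤ ∑ i, inner ℝ (Δ (u i)) (v j) ^ 2 :=
          Finset.sum_le_sum_of_subset_of_nonneg (Finset.subset_univ _) fun _ _ _ ↦ sq_nonneg _
      _ = ‖Δ (v j)‖ ^ 2 := by
          rw [norm_sq_eq_sum_inner u]
          exact Finset.sum_congr rfl fun i _ ↦ by rw [← hsymm]
      _ ≤ ‖Δ‖ ^ 2 := pow_le_pow_left₀ (norm_nonneg _)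
          (by simpa using Δ.le_opNorm (v j)) 2
  rcases hτ0.eq_or_lt with h0 | h0
  · rw [← h0, mul_zero]; positivity
  have hsq : (gap * τ) ^ 2 ≤ (X - Y) ^ 2 :=
    pow_le_pow_left₀ (mul_nonneg hgap.le hτ0) (hXY ▸ hdiff) 2
  have : (gap ^ 2 * τ) * τ ≤ (4 * d * ‖Δ‖ ^ 2) * τ := by
    nlinarith [sq_nonneg (X + Y)]
  exact le_of_mul_le_mul_right this h0

lemma IsEigenDecomp.gap_sq_mul_norm_topProj_sub_sq_le (h : IsEigenDecomp S u lam)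
    (h' : IsEigenDecomp S' v mu) {p q : Fin D} (hp : (p : ℕ) + 1 = d) (hq : (q : ℕ) = d)
    (hgap : 0 < lam p - lam q) :
    (lam p - lam q) ^ 2 * ‖topProj u d - topProj v d‖ ^ 2
      ≤ 8 * d * ‖toOp S - toOp S'‖ ^ 2 := by
  have h1 := h.gap_sq_mul_sinSq_le h' hp hq hgap
  have h2 := mul_le_mul_of_nonneg_left (norm_topProj_sub_sq_le u v d)
    (sq_nonneg (lam p - lam q))
  linarith

lemma norm_topProj_le (u : OrthonormalBasis (Fin D) ℝ (State D)) (d : ℕ) : ‖topProj u d‖ ≤ 1 :=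
  Submodule.starProjection_norm_le _

end Projections

/-- A `1/2`-net of the unit sphere of cardinality at most `5 ^ D`. -/
lemma exists_net (D : ℕ) : ∃ N : Finset (State D), N.card ≤ 5 ^ D ∧ (∀ y ∈ N, ‖y‖ = 1) ∧
    ∀ x : State D, ‖x‖ = 1 → ∃ y ∈ N, ‖x - y‖ ≤ 1 / 2 := by
  classical
  let Sep : Finset (State D) → Prop := fun N ↦
    (∀ y ∈ N, ‖y‖ = 1) ∧ ∀ y ∈ N, ∀ z ∈ N, y ≠ z → 1 / 2 ≤ ‖y - z‖
  have hcard : ∀ N, Sep N → N.card ≤ 5 ^ D := by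
    intro N hN
    have hinj : Function.Injective fun y : State D ↦ (2 : ℝ) • y :=
      smul_right_injective _ two_ne_zero
    -- Doubling turns `1/2`-separated unit vectors into `1`-separated points of the ball of radius
    -- `2`.
    have := Besicovitch.card_le_of_separated (N.image fun y ↦ (2 : ℝ) • y) (fun c hc ↦ ?_)
      (fun c hc e he hce ↦ ?_)
    · rwa [Finset.card_image_of_injective _ hinj, finrank_euclideanSpace_fin] at this
    · obtain ⟨y, hy, rfl⟩ := Finset.mem_image.1 hc
      simp [norm_smul, hN.1 y hy]
    · obtain ⟨y, hy, rfl⟩ := Finset.mem_image.1 hc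
      obtain ⟨z, hz, rfl⟩ := Finset.mem_image.1 he
      have := hN.2 y hy z hz fun h ↦ hce (by rw [h])
      rw [← smul_sub, norm_smul, Real.norm_two]
      linarith
  -- Without a net, any separated set can be enlarged, eventually beyond `5 ^ D` points.
  by_contra! hcon
  have hall : ∀ k, ∃ N, Sep N ∧ N.card = k := by
    intro k
    induction k with
    | zero => exact ⟨∅, ⟨by simp, by simp⟩, rfl⟩
    | succ k ih =>
      obtain ⟨N, hN, rfl⟩ := ih
      obtain ⟨x, hx, hxN⟩ := hcon N (hcard N hN) hN.1
      have hxnot : x ∉ N := fun h ↦ by have := hxN x h; norm_num at this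
      refine ⟨insert x N, ⟨?_, ?_⟩, Finset.card_insert_of_notMem hxnot⟩
      · simpa [hx] using hN.1
      · intro y hy z hz hyz
        rcases Finset.mem_insert.1 hy with rfl | hy' <;> rcases Finset.mem_insert.1 hz with rfl | hz'
        · exact absurd rfl hyz
        · exact (hxN z hz').le
        · rw [norm_sub_rev]; exact (hxN y hy').le
        · exact hN.2 y hy' z hz' hyz
  obtain ⟨N, hN, hk⟩ := hall (5 ^ D + 1)
  have := hcard N hN
  omega

/-- For symmetric `T` the quadratic forms at `x` and `y` differ by `⟨x - y, T (x + y)⟩`. The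
triangle inequality would bound the product of the two norms only by `1`; the parallelogram law
gives `√(15/16) < 31/32`, so the error is absorbed at the cost of a factor `32`. -/
lemma norm_le_of_net {T : State D →L[ℝ] State D}
    (hT : ∀ x y, inner ℝ x (T y) = inner ℝ (T x) y) {N : Finset (State D)}
    (hN1 : ∀ y ∈ N, ‖y‖ = 1) (hN : ∀ x : State D, ‖x‖ = 1 → ∃ y ∈ N, ‖x - y‖ ≤ 1 / 2)
    {m : ℝ} (hm0 : 0 ≤ m) (hm : ∀ y ∈ N, |inner ℝ y (T y)| ≤ m) : ‖T‖ ≤ 32 * m := by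
  have hsym : (T : State D →ₗ[ℝ] State D).IsSymmetric := fun x y ↦ (hT x y).symm
  have hunit : ∀ x : State D, ‖x‖ = 1 → |inner ℝ x (T x)| ≤ m + 31 / 32 * ‖T‖ := by
    intro x hx
    obtain ⟨y, hy, hxy⟩ := hN x hx
    have e : inner ℝ x (T x) = inner ℝ y (T y) + inner ℝ (x - y) (T (x + y)) := by
      have := hT y x
      rw [real_inner_comm x (T y)] at this
      simp only [map_add, inner_add_right, inner_sub_left]
      linarith
    have hpar := parallelogram_law_with_norm ℝ x y
    rw [hx, hN1 y hy] at hpar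
    have hprod : ‖x - y‖ * ‖x + y‖ ≤ 31 / 32 := by
      have h0 := norm_nonneg (x - y)
      have h1 := norm_nonneg (x + y)
      have hs : ‖x - y‖ * ‖x - y‖ ≤ 1 / 4 := by nlinarith
      refine abs_le_of_sq_le_sq' ?_ (by norm_num) |>.2
      have : ‖x + y‖ * ‖x + y‖ = 4 - ‖x - y‖ * ‖x - y‖ := by linarith
      calc (‖x - y‖ * ‖x + y‖) ^ 2 = (‖x - y‖ * ‖x - y‖) * (‖x + y‖ * ‖x + y‖) := by ring
        _ = (‖x - y‖ * ‖x - y‖) * (4 - ‖x - y‖ * ‖x - y‖) := by rw [this]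
        _ ≤ (31 / 32) ^ 2 := by nlinarith
    have hb : |inner ℝ (x - y) (T (x + y))| ≤ 31 / 32 * ‖T‖ :=
      calc _ ≤ ‖x - y‖ * ‖T (x + y)‖ := abs_real_inner_le_norm _ _
        _ ≤ ‖x - y‖ * (‖T‖ * ‖x + y‖) := by gcongr; exact T.le_opNorm _
        _ = (‖x - y‖ * ‖x + y‖) * ‖T‖ := by ring
        _ ≤ _ := by gcongr
    rw [e]
    exact (abs_add_le _ _).trans (add_le_add (hm y hy) hb)
  have : ‖T‖ ≤ m + 31 / 32 * ‖T‖ := by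
    conv_lhs => rw [T.norm_eq_iSup_rayleighQuotient hsym]
    refine ciSup_le fun x ↦ ?_
    rcases eq_or_ne x 0 with rfl | hx
    · simp only [ContinuousLinearMap.rayleighQuotient_apply_zero, abs_zero]
      positivity
    · have hx' : ‖x‖ ≠ 0 := norm_ne_zero_iff.2 hx
      rw [← T.rayleigh_smul x (inv_ne_zero hx')]
      have h1 : ‖(‖x‖⁻¹ : ℝ) • x‖ = 1 := by
        rw [norm_smul, norm_inv, norm_norm, inv_mul_cancel₀ hx']
      have := hunit _ h1
      rw [ContinuousLinearMap.rayleighQuotient, h1, ContinuousLinearMap.reApplyInnerSelf_apply]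
      rw [real_inner_comm] at this
      simpa using this
  linarith

end

/-! ### Bernstein's inequality and concentration of the empirical covariance. -/

section

section Bernstein

/-- The second-order Taylor remainder uses at most half of the exponent `|x|`; the other half
absorbs `x ^ 2`. -/
lemma exp_mul_le {θ x : ℝ} (hθ : |θ| ≤ 1 / 2) :
    Real.exp (θ * x) ≤ 1 + θ * x + 8 * θ ^ 2 * Real.exp |x| := by
  have h1 : |Real.exp (θ * x) - (1 + θ * x)| ≤ |θ * x| ^ 2 * Real.exp |θ * x| := by
    have := Complex.norm_exp_sub_sum_le_norm_mul_exp ((θ * x : ℝ) : ℂ) 2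
    rw [Complex.norm_real, Real.norm_eq_abs] at this
    convert this using 1
    rw [← Real.norm_eq_abs, ← Complex.norm_real]
    simp [Finset.sum_range_succ]
  have h2 : Real.exp |θ * x| ≤ Real.exp (|x| / 2) := by
    rw [abs_mul]
    exact Real.exp_le_exp.2 (by nlinarith [abs_nonneg x])
  have h3 : x ^ 2 ≤ 8 * Real.exp (|x| / 2) := by
    have := Real.quadratic_le_exp_of_nonneg (x := |x| / 2) (by positivity)
    have h4 := sq_abs x
    nlinarith [abs_nonneg x]
  have h4 : Real.exp |x| = Real.exp (|x| / 2) * Real.exp (|x| / 2) := by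
    rw [← Real.exp_add, add_halves]
  have h5 : |θ * x| ^ 2 * Real.exp |θ * x| ≤ 8 * θ ^ 2 * Real.exp |x| := by
    rw [sq_abs, mul_pow, h4]
    calc θ ^ 2 * x ^ 2 * Real.exp |θ * x|
        ≤ θ ^ 2 * (8 * Real.exp (|x| / 2)) * Real.exp (|x| / 2) := by gcongr
      _ = _ := by ring
  linarith [(abs_le.1 h1).2]

variable {S : Type*} [MeasurableSpace S] {ν : Measure S} {Z : S → ℝ}

lemma integrable_exp_of_lintegral_le (hZ : Measurable Z)
    (h : ∫⁻ s, ENNReal.ofReal (Real.exp (Z s)) ∂ν ≤ 2) :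
    Integrable (fun s ↦ Real.exp (Z s)) ν := by
  refine ⟨(Real.measurable_exp.comp hZ).aestronglyMeasurable, ?_⟩
  rw [hasFiniteIntegral_iff_ofReal (.of_forall fun s ↦ (Real.exp_pos _).le)]
  exact h.trans_lt (by simp)

lemma integral_exp_le_two (hZ : Measurable Z)
    (h : ∫⁻ s, ENNReal.ofReal (Real.exp (Z s)) ∂ν ≤ 2) : ∫ s, Real.exp (Z s) ∂ν ≤ 2 := by
  rw [integral_eq_lintegral_of_nonneg_ae (.of_forall fun s ↦ (Real.exp_pos _).le)
    (Real.measurable_exp.comp hZ).aestronglyMeasurable]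
  exact ENNReal.toReal_le_of_le_ofReal (by norm_num) (by simpa using h)

lemma integrable_of_lintegral_exp_le (hZ : Measurable Z) (hZ0 : ∀ s, 0 ≤ Z s)
    (h : ∫⁻ s, ENNReal.ofReal (Real.exp (Z s)) ∂ν ≤ 2) : Integrable Z ν :=
  (integrable_exp_of_lintegral_le hZ h).mono' hZ.aestronglyMeasurable (.of_forall fun s ↦ by
    rw [Real.norm_eq_abs, abs_of_nonneg (hZ0 s)]
    linarith [Real.add_one_le_exp (Z s)])

variable [IsProbabilityMeasure ν]

lemma integral_le_one_of_lintegral_exp_le (hZ : Measurable Z) (hZ0 : ∀ s, 0 ≤ Z s)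
    (h : ∫⁻ s, ENNReal.ofReal (Real.exp (Z s)) ∂ν ≤ 2) : ∫ s, Z s ∂ν ≤ 1 := by
  have hi := integrable_of_lintegral_exp_le hZ hZ0 h
  have : ∫ s, (Z s + 1) ∂ν ≤ ∫ s, Real.exp (Z s) ∂ν :=
    integral_mono (hi.add (integrable_const _)) (integrable_exp_of_lintegral_le hZ h)
      fun s ↦ Real.add_one_le_exp _
  rw [integral_add hi (integrable_const _)] at this
  simp only [integral_const, probReal_univ, smul_eq_mul, mul_one] at this
  linarith [integral_exp_le_two hZ h]

/-- Centred nonnegative variables with `𝔼 exp Z ≤ 2` are sub-exponential. -/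
lemma integrable_exp_and_mgf_le (hZ : Measurable Z) (hZ0 : ∀ s, 0 ≤ Z s)
    (h : ∫⁻ s, ENNReal.ofReal (Real.exp (Z s)) ∂ν ≤ 2) {θ : ℝ} (hθ : |θ| ≤ 1 / 2) :
    Integrable (fun s ↦ Real.exp (θ * (Z s - ∫ s, Z s ∂ν))) ν ∧
      ∫ s, Real.exp (θ * (Z s - ∫ s, Z s ∂ν)) ∂ν ≤ Real.exp (48 * θ ^ 2) := by
  have hi := integrable_of_lintegral_exp_le hZ hZ0 h
  have hm1 := integral_le_one_of_lintegral_exp_le hZ hZ0 h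
  have hm0 : 0 ≤ ∫ s, Z s ∂ν := integral_nonneg hZ0
  set m := ∫ s, Z s ∂ν with hm
  have hie := integrable_exp_of_lintegral_le hZ h
  have habs : ∀ s, |Z s - m| ≤ 1 + Z s := fun s ↦
    abs_le.2 ⟨by linarith [hZ0 s], by linarith⟩
  have hexp : ∀ s, Real.exp |Z s - m| ≤ Real.exp 1 * Real.exp (Z s) := fun s ↦ by
    rw [← Real.exp_add]; exact Real.exp_le_exp.2 (habs s)
  have hint : Integrable (fun s ↦ Real.exp (θ * (Z s - m))) ν := by
    refine (hie.const_mul (Real.exp 1)).mono' (by fun_prop) (.of_forall fun s ↦ ?_)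
    rw [Real.norm_eq_abs, Real.abs_exp]
    refine le_trans (Real.exp_le_exp.2 ?_) (hexp s)
    calc θ * (Z s - m) ≤ |θ * (Z s - m)| := le_abs_self _
      _ = |θ| * |Z s - m| := abs_mul _ _
      _ ≤ 1 * |Z s - m| := by gcongr; linarith
      _ = _ := one_mul _
  refine ⟨hint, ?_⟩
  have hb : Integrable (fun s ↦ 1 + θ * (Z s - m)) ν :=
    (integrable_const _).add ((hi.sub (integrable_const _)).const_mul _)
  have hlin : Integrable (fun s ↦ θ * (Z s - m)) ν := (hi.sub (integrable_const _)).const_mul _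
  have hc : Integrable (fun s ↦ 8 * θ ^ 2 * (Real.exp 1 * Real.exp (Z s))) ν :=
    (hie.const_mul _).const_mul _
  calc ∫ s, Real.exp (θ * (Z s - m)) ∂ν
      ≤ ∫ s, (1 + θ * (Z s - m)) + 8 * θ ^ 2 * (Real.exp 1 * Real.exp (Z s)) ∂ν := by
        refine integral_mono hint (hb.add hc) fun s ↦ (exp_mul_le hθ).trans ?_
        gcongr
        exact hexp s
    _ = 1 + 8 * θ ^ 2 * (Real.exp 1 * ∫ s, Real.exp (Z s) ∂ν) := by
        rw [integral_add hb hc, integral_add (integrable_const _) hlin, integral_const_mul,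
          integral_const_mul, integral_const_mul, integral_sub hi (integrable_const _)]
        simp [hm]
    -- Here `3` bounds `e` and `2` bounds the exponential moment.
    _ ≤ 1 + 8 * θ ^ 2 * (3 * 2) := by
        have := Real.exp_one_lt_d9
        have hE : 0 ≤ ∫ s, Real.exp (Z s) ∂ν := integral_nonneg fun s ↦ (Real.exp_pos _).le
        have := integral_exp_le_two hZ h
        gcongr
        linarith
    _ = 48 * θ ^ 2 + 1 := by ring
    _ ≤ _ := Real.add_one_le_exp _

variable {Ω : Type*} [MeasurableSpace Ω] {Pr : Measure Ω} [IsProbabilityMeasure Pr] {n : ℕ}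

lemma measure_sum_ge_le_of_mgf_le {W : Fin n → Ω → ℝ} (hind : iIndepFun W Pr)
    (hmeas : ∀ j, AEMeasurable (W j) Pr) {θ c η : ℝ} (hθ : 0 ≤ θ)
    (hint : ∀ j, Integrable (fun ω ↦ Real.exp (θ * W j ω)) Pr)
    (hmgf : ∀ j, mgf (W j) Pr θ ≤ Real.exp c) :
    Pr.real {ω | η ≤ ∑ j, W j ω} ≤ Real.exp (n * c - θ * η) := by
  have hprod := hind.mgf_sum₀ (t := θ) hmeas Finset.univ
  have hpos : 0 < ∏ j, mgf (W j) Pr θ := Finset.prod_pos fun j _ ↦ mgf_pos (hint j)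
  have hI : Integrable (fun ω ↦ Real.exp (θ * (∑ j, W j) ω)) Pr := by
    -- A non-integrable exponential would have `mgf` equal to `0` by convention, but the product of
    -- the factors is positive.
    by_contra hcon
    rw [mgf_undef hcon] at hprod
    exact hpos.ne hprod
  have h := measure_ge_le_exp_mul_mgf (μ := Pr) (X := ∑ j, W j) η hθ hI
  simp only [Finset.sum_apply] at h
  refine h.trans ?_
  rw [hprod]
  calc Real.exp (-θ * η) * ∏ j, mgf (W j) Pr θ
      ≤ Real.exp (-θ * η) * ∏ _j : Fin n, Real.exp c := by
        gcongr with j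
        · exact fun j _ ↦ mgf_nonneg
        · exact hmgf j
    _ = _ := by
        rw [Finset.prod_const, Finset.card_univ, Fintype.card_fin, ← Real.exp_nat_mul,
          ← Real.exp_add]
        congr 1; ring

/-- Bernstein's inequality for nonnegative variables with `𝔼 exp Z ≤ 2`. -/
lemma measure_abs_sum_sub_ge_le (hZ : Measurable Z) (hZ0 : ∀ s, 0 ≤ Z s)
    (h : ∫⁻ s, ENNReal.ofReal (Real.exp (Z s)) ∂ν ≤ 2) {X : Fin n → Ω → S}
    (hind : iIndepFun X Pr) (hlaw : ∀ j, HasLaw (X j) ν Pr) {η : ℝ} (hη0 : 0 ≤ η) (hη : η ≤ 1) :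
    Pr.real {ω | n * η ≤ |∑ j, (Z (X j ω) - ∫ s, Z s ∂ν)|}
      ≤ 2 * Real.exp (-(n * η ^ 2 / 192)) := by
  set m := ∫ s, Z s ∂ν
  have hone : ∀ σ : ℝ, |σ| = 1 →
      Pr.real {ω | n * η ≤ ∑ j, σ * (Z (X j ω) - m)} ≤ Real.exp (-(n * η ^ 2 / 192)) := by
    intro σ hσ
    have hg : Measurable fun s ↦ σ * (Z s - m) := by fun_prop
    have hind' : iIndepFun (fun j ω ↦ σ * (Z (X j ω) - m)) Pr :=
      hind.comp (fun _ s ↦ σ * (Z s - m)) fun _ ↦ hg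
    have hθ : |η / 96 * σ| ≤ 1 / 2 := by
      rw [abs_mul, hσ, abs_of_nonneg (by positivity)]; linarith
    have hb := integrable_exp_and_mgf_le hZ hZ0 h hθ
    have hfun : (fun s ↦ Real.exp (η / 96 * σ * (Z s - m)))
        = fun s ↦ Real.exp (η / 96 * (σ * (Z s - m))) := by
      funext s; rw [mul_assoc]
    have hσ2 : σ ^ 2 = 1 := by rw [← sq_abs, hσ, one_pow]
    refine (measure_sum_ge_le_of_mgf_le hind'
      (fun j ↦ hg.comp_aemeasurable (hlaw j).aemeasurable)
      -- The minimizer of `48 * θ ^ 2 - θ * η`, with minimum `-η ^ 2 / 192`.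
      (θ := η / 96) (c := 48 * (η / 96) ^ 2) (by positivity) (fun j ↦ ?_)
      (fun j ↦ ?_)).trans (le_of_eq ?_)
    · have := hb.1
      rw [hfun, ← (hlaw j).map_eq] at this
      exact this.comp_aemeasurable (hlaw j).aemeasurable
    · rw [mgf]
      have e := (hlaw j).integral_comp (f := fun s ↦ Real.exp (η / 96 * (σ * (Z s - m))))
        (by fun_prop)
      have := hb.2
      rw [mul_pow, hσ2, mul_one, hfun, ← e] at this
      exact this
    · congr 1; ring
  have hsub : {ω | n * η ≤ |∑ j, (Z (X j ω) - m)|} ⊆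
      {ω | n * η ≤ ∑ j, 1 * (Z (X j ω) - m)} ∪ {ω | n * η ≤ ∑ j, (-1) * (Z (X j ω) - m)} := by
    intro ω hω
    simp only [Set.mem_union, Set.mem_ofPred_eq, ← Finset.mul_sum] at hω ⊢
    rcases le_abs.1 hω with h | h
    · left; linarith
    · right; linarith
  refine (measureReal_mono hsub).trans ((measureReal_union_le _ _).trans ?_)
  rw [two_mul]
  exact add_le_add (hone 1 (by simp)) (hone (-1) (by simp))

end Bernstein

variable {D : ℕ}

lemma toOp_symm {S : Matrix (Fin D) (Fin D) ℝ} (hS : ∀ i j, S i j = S j i) (x y : State D) :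
    inner ℝ x (toOp S y) = inner ℝ (toOp S x) y := by
  rw [real_inner_comm y (toOp S x), inner_toOp, inner_toOp, Finset.sum_comm]
  exact Finset.sum_congr rfl fun i _ ↦ Finset.sum_congr rfl fun j _ ↦ by rw [hS]; ring

lemma inner_toOp_empCov {n : ℕ} (x : Fin n → State D) (y : State D) :
    inner ℝ y (toOp (empCov x) y) = 1 / n * ∑ j, inner ℝ (x j) y ^ 2 := by
  rw [toOp, empCov, map_smul, map_sum, smul_apply, sum_apply, inner_smul_right, inner_sum]
  congr 1
  refine Finset.sum_congr rfl fun j _ ↦ ?_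
  rw [sq]
  exact inner_toOp_vecMulVec _ _ _

lemma empCov_symm {n : ℕ} (x : Fin n → State D) (i k : Fin D) : empCov x i k = empCov x k i := by
  simp [empCov, Matrix.sum_apply, Matrix.vecMulVec_apply, mul_comm]

section SecondMoment

variable {ν : Measure (State D)}

lemma secondMoment_symm (i j : Fin D) : secondMoment ν i j = secondMoment ν j i := by
  simp [secondMoment, mul_comm]

lemma inner_toOp_secondMoment (hν : ∀ y, MemLp (fun s : State D ↦ inner ℝ s y) 2 ν)
    (y : State D) : inner ℝ y (toOp (secondMoment ν) y) = ∫ s, inner ℝ s y ^ 2 ∂ν := by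
  have hc : ∀ i : Fin D, MemLp (fun s : State D ↦ s i) 2 ν := fun i ↦ by
    simpa [EuclideanSpace.inner_single_right] using hν (EuclideanSpace.single i 1)
  have hij : ∀ i j : Fin D, Integrable (fun s : State D ↦ s i * s j) ν := fun i j ↦
    (hc i).integrable_mul (hc j)
  have : ∀ s : State D, inner ℝ s y ^ 2 = ∑ i, ∑ j, s i * s j * (y i * y j) := fun s ↦ by
    rw [sq, inner_eq_sum, Finset.sum_mul_sum]
    exact Finset.sum_congr rfl fun i _ ↦ Finset.sum_congr rfl fun j _ ↦ by ring
  simp_rw [this]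
  rw [inner_toOp, integral_finsetSum _ fun i _ ↦ integrable_finsetSum _ fun j _ ↦
    (hij i j).mul_const _]
  refine Finset.sum_congr rfl fun i _ ↦ ?_
  rw [integral_finsetSum _ fun j _ ↦ (hij i j).mul_const _]
  exact Finset.sum_congr rfl fun j _ ↦ by rw [integral_mul_const]; rfl

variable [IsProbabilityMeasure ν]

/-- Concentration of the empirical covariance matrix. -/
lemma exists_event_norm_sub_le {t : ℝ} (ht : 0 < t)
    (hν : ∀ y, MemLp (fun s : State D ↦ inner ℝ s y) 2 ν)
    (hexp : ∀ y : State D, ‖y‖ = 1 →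
      ∫⁻ s, ENNReal.ofReal (Real.exp (inner ℝ s y ^ 2 / t ^ 2)) ∂ν ≤ 2)
    {Ω : Type*} [MeasurableSpace Ω] {Pr : Measure Ω} [IsProbabilityMeasure Pr] {n : ℕ}
    (hn : 0 < n) {X : Fin n → Ω → State D} (hind : iIndepFun X Pr)
    (hlaw : ∀ j, HasLaw (X j) ν Pr) {η δ : ℝ} (hη0 : 0 ≤ η) (hη : η ≤ 1)
    (hδ : 5 ^ D * (2 * Real.exp (-(n * η ^ 2 / 192))) ≤ δ) :
    ∃ G : Set Ω, MeasurableSet G ∧ ENNReal.ofReal (1 - δ) ≤ Pr G ∧ ∀ ω ∈ G,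
      ‖toOp (secondMoment ν) - toOp (empCov fun j ↦ X j ω)‖ ≤ 32 * (t ^ 2 * η) := by
  obtain ⟨N, hNcard, hN1, hN⟩ := exists_net D
  set Z : State D → State D → ℝ := fun y s ↦ inner ℝ s y ^ 2 / t ^ 2 with hZ
  have hZm : ∀ y, Measurable (Z y) := fun y ↦ by simp only [hZ]; fun_prop
  have hZ0 : ∀ y s, 0 ≤ Z y s := fun y s ↦ by simp only [hZ]; positivity
  set bad : State D → Set Ω := fun y ↦
    {ω | n * η ≤ |∑ j, (Z y (X j ω) - ∫ s, Z y s ∂ν)|} with hbad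
  have hbadle : ∀ y ∈ N, Pr.real (bad y) ≤ 2 * Real.exp (-(n * η ^ 2 / 192)) := fun y hy ↦
    measure_abs_sum_sub_ge_le (hZm y) (hZ0 y) (hexp y (hN1 y hy)) hind hlaw hη0 hη
  have hBle : Pr.real (⋃ y ∈ N, bad y) ≤ δ := by
    refine (measureReal_biUnion_finset_le _ _).trans ((Finset.sum_le_sum hbadle).trans ?_)
    rw [Finset.sum_const, nsmul_eq_mul]
    refine le_trans (mul_le_mul_of_nonneg_right ?_ (by positivity)) hδ
    exact_mod_cast hNcard
  have hn' : (n : ℝ) ≠ 0 := by positivity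
  -- The samples are only almost everywhere measurable, so the bad event is replaced by a measurable
  -- hull of the same probability.
  refine ⟨(toMeasurable Pr (⋃ y ∈ N, bad y))ᶜ, (measurableSet_toMeasurable _ _).compl, ?_,
    fun ω hω ↦ ?_⟩
  · rw [prob_compl_eq_one_sub (measurableSet_toMeasurable _ _), measure_toMeasurable,
      ENNReal.ofReal_sub _ (measureReal_nonneg.trans hBle), ENNReal.ofReal_one]
    refine tsub_le_tsub_left ?_ _
    rw [← ofReal_measureReal (measure_ne_top _ _)]
    exact ENNReal.ofReal_le_ofReal hBle
  · have hωB : ∀ y ∈ N, |∑ j, (Z y (X j ω) - ∫ s, Z y s ∂ν)| < n * η := fun y hy ↦ by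
      by_contra hcon
      refine hω (subset_toMeasurable _ _ (Set.mem_biUnion hy ?_))
      exact not_lt.1 hcon
    refine norm_le_of_net (fun x y ↦ ?_) hN1 hN (by positivity) fun y hy ↦ ?_
    · rw [sub_apply, sub_apply, inner_sub_left, inner_sub_right, toOp_symm secondMoment_symm,
        toOp_symm (empCov_symm _)]
    · have hsum := hωB y hy
      simp only [hZ] at hsum
      rw [integral_div, Finset.sum_sub_distrib, ← Finset.sum_div, Finset.sum_const,
        Finset.card_univ, Fintype.card_fin, nsmul_eq_mul] at hsum
      rw [sub_apply, inner_sub_right, inner_toOp_secondMoment hν, inner_toOp_empCov]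
      have e : ∫ s, inner ℝ s y ^ 2 ∂ν - 1 / n * ∑ j, inner ℝ (X j ω) y ^ 2
          = -(t ^ 2 / n) * ((∑ j, inner ℝ (X j ω) y ^ 2) / t ^ 2
            - n * ((∫ s, inner ℝ s y ^ 2 ∂ν) / t ^ 2)) := by
        field_simp
        ring
      rw [e, abs_mul, abs_neg, abs_of_nonneg (by positivity)]
      calc _ ≤ t ^ 2 / n * (n * η) := by gcongr
        _ = _ := by field_simp

end SecondMoment

section SubGaussian

variable {ν : Measure (State D)}

/-- Strict inequality yields an admissible parameter below `t`, so attainment of the infimum is not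
at issue. -/
lemma lintegral_exp_le_two_of_psi2Norm_lt {Ω : Type*} [MeasurableSpace Ω] {P : Measure Ω}
    {Y : Ω → ℝ} {t : ℝ} (h : psi2Norm P Y < ENNReal.ofReal t) :
    ∫⁻ ω, ENNReal.ofReal (Real.exp (Y ω ^ 2 / t ^ 2)) ∂P ≤ 2 := by
  simp only [psi2Norm, iInf_lt_iff] at h
  obtain ⟨r, ⟨hr0, hr⟩, hrt⟩ := h
  have hrt' : r < t := (ENNReal.ofReal_lt_ofReal_iff_of_nonneg hr0.le).1 hrt
  refine le_trans (lintegral_mono fun ω ↦ ENNReal.ofReal_le_ofReal (Real.exp_le_exp.2 ?_)) hr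
  gcongr

lemma integral_sq_le_of_lintegral_exp_le [IsProbabilityMeasure ν] {y : State D} {t : ℝ}
    (ht : 0 < t)
    (h : ∫⁻ s, ENNReal.ofReal (Real.exp (inner ℝ s y ^ 2 / t ^ 2)) ∂ν ≤ 2) :
    MemLp (fun s : State D ↦ inner ℝ s y) 2 ν ∧ ∫ s, inner ℝ s y ^ 2 ∂ν ≤ t ^ 2 := by
  have hm : Measurable fun s : State D ↦ inner ℝ s y ^ 2 / t ^ 2 := by fun_prop
  have h0 : ∀ s : State D, 0 ≤ inner ℝ s y ^ 2 / t ^ 2 := fun s ↦ by positivity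
  have hi := integrable_of_lintegral_exp_le hm h0 h
  have h1 := integral_le_one_of_lintegral_exp_le hm h0 h
  rw [integral_div, div_le_one (by positivity)] at h1
  refine ⟨(memLp_two_iff_integrable_sq (by fun_prop)).2 ?_, h1⟩
  refine (hi.mul_const (t ^ 2)).congr (.of_forall fun s ↦ ?_)
  exact div_mul_cancel₀ _ (pow_pos ht 2).ne'

lemma eLpNorm_two_le_iff {Ω : Type*} [MeasurableSpace Ω] {P : Measure Ω} {Y : Ω → ℝ}
    (hY : MemLp Y 2 P) {c : ℝ} (hc : 0 ≤ c) :
    eLpNorm Y 2 P ≤ ENNReal.ofReal c ↔ ∫ ω, Y ω ^ 2 ∂P ≤ c ^ 2 := by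
  rw [hY.eLpNorm_eq_integral_rpow_norm two_ne_zero ENNReal.ofNat_ne_top,
    ENNReal.ofReal_le_ofReal_iff hc]
  have h0 : 0 ≤ ∫ ω, Y ω ^ 2 ∂P := integral_nonneg fun _ ↦ sq_nonneg _
  simp only [ENNReal.toReal_ofNat, Real.rpow_ofNat, Real.norm_eq_abs, sq_abs]
  rw [← one_div, ← Real.sqrt_eq_rpow, Real.sqrt_le_left hc]

variable [IsProbabilityMeasure ν] {K : ℝ}

lemma IsSubGaussian.memLp (h : IsSubGaussian ν K) (y : State D) :
    MemLp (fun s : State D ↦ inner ℝ s y) 2 ν := by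
  obtain ⟨t, ht⟩ := ENNReal.lt_iff_exists_nnreal_btwn.1 (h y).1
  have ht0 : (0 : ℝ) < t := by
    have := lt_of_le_of_lt zero_le ht.1
    exact_mod_cast this
  refine (integral_sq_le_of_lintegral_exp_le ht0 (lintegral_exp_le_two_of_psi2Norm_lt ?_)).1
  simpa using ht.1

lemma IsSubGaussian.eLpNorm_le_psi2Norm (h : IsSubGaussian ν K) (y : State D) :
    eLpNorm (fun s : State D ↦ inner ℝ s y) 2 ν ≤ psi2Norm ν fun s ↦ inner ℝ s y := by
  refine le_iInf₂ fun t ht ↦ ?_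
  exact (eLpNorm_two_le_iff (h.memLp y) ht.1.le).2 (integral_sq_le_of_lintegral_exp_le ht.1 ht.2).2

/-- The `L²` norm is at most the `ψ₂` norm, hence at most `K` times itself; being finite and nonzero
it can be cancelled. -/
lemma IsSubGaussian.one_le (h : IsSubGaussian ν K) {y : State D}
    (hy : 0 < ∫ s, inner ℝ s y ^ 2 ∂ν) : 1 ≤ K := by
  have hne : eLpNorm (fun s : State D ↦ inner ℝ s y) 2 ν ≠ 0 := fun h0 ↦ by
    have := (eLpNorm_two_le_iff (h.memLp y) le_rfl).1 (by simp [h0])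
    simp only [ne_eq, OfNat.ofNat_ne_zero, not_false_eq_true, zero_pow] at this
    linarith
  have h1 := (h.eLpNorm_le_psi2Norm y).trans (h y).2
  by_contra hK
  have hlt : ENNReal.ofReal K < 1 := by
    rw [← ENNReal.ofReal_one]
    exact (ENNReal.ofReal_lt_ofReal_iff one_pos).2 (not_le.1 hK)
  have := ENNReal.mul_lt_mul_left hne (h.memLp y).2.ne hlt
  rw [one_mul] at this
  exact absurd h1 (not_le.2 this)

/-- The factor `2` supplies the strict inequality required by `lintegral_exp_le_two_of_psi2Norm_lt`.
-/
lemma IsSubGaussian.lintegral_exp_le (h : IsSubGaussian ν K) (hK : 1 ≤ K)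
    (hpos : 0 < specNorm (secondMoment ν)) {y : State D} (hy : ‖y‖ = 1) :
    ∫⁻ s, ENNReal.ofReal
      (Real.exp (inner ℝ s y ^ 2 / (2 * K * √(specNorm (secondMoment ν))) ^ 2)) ∂ν ≤ 2 := by
  refine lintegral_exp_le_two_of_psi2Norm_lt ?_
  have hs : 0 < √(specNorm (secondMoment ν)) := Real.sqrt_pos.2 hpos
  have h1 : eLpNorm (fun s : State D ↦ inner ℝ s y) 2 ν
      ≤ ENNReal.ofReal √(specNorm (secondMoment ν)) := by
    rw [eLpNorm_two_le_iff (h.memLp y) hs.le, Real.sq_sqrt hpos.le,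
      ← inner_toOp_secondMoment h.memLp]
    calc _ ≤ ‖y‖ * ‖toOp (secondMoment ν) y‖ := real_inner_le_norm _ _
      _ ≤ ‖y‖ * (‖toOp (secondMoment ν)‖ * ‖y‖) := by gcongr; exact (toOp _).le_opNorm y
      _ = _ := by rw [hy, one_mul, mul_one]; rfl
  calc _ ≤ ENNReal.ofReal K * ENNReal.ofReal √(specNorm (secondMoment ν)) :=
        (h y).2.trans (by gcongr)
    _ = ENNReal.ofReal (K * √(specNorm (secondMoment ν))) :=
        (ENNReal.ofReal_mul (by linarith)).symm
    _ < _ := (ENNReal.ofReal_lt_ofReal_iff (by positivity)).2 (by nlinarith)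

end SubGaussian

end

/-! ### Suboptimality of a sanitized policy, and the union bound numerics. -/

section

variable {D : ℕ}

section Moments

variable {ν : Measure (State D)}

lemma memLp_inner_left (hν : ∀ y, MemLp (fun s : State D ↦ inner ℝ s y) 2 ν) (y : State D) :
    MemLp (fun s : State D ↦ inner ℝ y s) 2 ν := by
  simpa only [real_inner_comm] using hν y

lemma memLp_norm (hν : ∀ y, MemLp (fun s : State D ↦ inner ℝ s y) 2 ν)
    (u : OrthonormalBasis (Fin D) ℝ (State D)) : MemLp (fun s : State D ↦ ‖s‖) 2 ν := by
  refine (memLp_two_iff_integrable_sq (by fun_prop)).2 ?_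
  simp_rw [norm_sq_eq_sum_inner u]
  exact integrable_finsetSum _ fun i _ ↦ (memLp_inner_left hν (u i)).integrable_sq

/-- The expected distance to the top eigenspace is controlled by the remaining eigenvalues. -/
lemma integral_norm_sub_topProj_le [IsProbabilityMeasure ν]
    (hν : ∀ y, MemLp (fun s : State D ↦ inner ℝ s y) 2 ν)
    {u : OrthonormalBasis (Fin D) ℝ (State D)} {lam : Fin D → ℝ}
    (hu : IsEigenDecomp (secondMoment ν) u lam) (d : ℕ) :
    ∫ s, ‖s - topProj u d s‖ ∂ν
      ≤ √(∑ i ∈ Finset.univ.filter (fun i : Fin D ↦ d ≤ (i : ℕ)), lam i) := by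
  have hfilter : Finset.univ.filter (fun i : Fin D ↦ d ≤ (i : ℕ)) = (topIdx D d)ᶜ := by
    ext i; simp
  have hmem : MemLp (fun s ↦ ‖s - topProj u d s‖) 2 ν := by
    refine (memLp_two_iff_integrable_sq (by fun_prop)).2 ?_
    simp_rw [norm_sub_topProj_sq]
    exact integrable_finsetSum _ fun i _ ↦ (memLp_inner_left hν (u i)).integrable_sq
  have hsq : ∫ s, ‖s - topProj u d s‖ ^ 2 ∂ν = ∑ i ∈ (topIdx D d)ᶜ, lam i := by
    simp_rw [norm_sub_topProj_sq]
    rw [integral_finsetSum _ fun i _ ↦ (memLp_inner_left hν (u i)).integrable_sq]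
    refine Finset.sum_congr rfl fun i _ ↦ ?_
    rw [← hu.inner_basis i, inner_toOp_secondMoment hν]
    simp only [real_inner_comm]
  -- Nonnegative variance bounds the mean distance by the root mean square.
  have hvar := variance_nonneg (fun s ↦ ‖s - topProj u d s‖) ν
  rw [variance_eq_sub hmem] at hvar
  simp only [Pi.pow_apply] at hvar
  rw [hfilter, ← hsq]
  exact Real.le_sqrt_of_sq_le (by linarith)

end Moments

variable {A : Type*} [MeasurableSpace A] [Countable A] [DiscreteMeasurableSpace A]

/-- Suboptimality of the policy sanitized with an arbitrary top projection. -/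
lemma optValue_sub_value_le (M : MDP D A) {πs πb : Policy D A}
    (hopt : M.value πs.toHPolicy = M.optValue)
    (hagree : ∀ᵐ s ∂(M.occupancy πs.toHPolicy), πb.act s = πs.act s)
    (hν : ∀ y, MemLp (fun s : State D ↦ inner ℝ s y) 2 (M.occupancy πs.toHPolicy))
    {u : OrthonormalBasis (Fin D) ℝ (State D)} {lam : Fin D → ℝ}
    (hu : IsEigenDecomp (secondMoment (M.occupancy πs.toHPolicy)) u lam) (d : ℕ)
    {L : ℝ} (hL : πb.IsLipschitz L) (hL0 : 0 ≤ L)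
    {f : Trigger D} (hf : ∀ t h, f.fn t h ∈ botSpace u d)
    {B : ℝ} (hB : f.IsBoundedInExpectation M B) (T : State D →L[ℝ] State D) :
    M.optValue - M.value ((πb.precomp T).triggered f)
      ≤ L / (1 - M.γ) ^ 2 * √(∑ i ∈ Finset.univ.filter (fun i : Fin D ↦ d ≤ (i : ℕ)), lam i)
        + L * B * ‖topProj u d - T‖ / (1 - M.γ) ^ 2 := by
  have h1 := M.abs_value_sub_precomp_le hL hagree
    ((memLp_norm hν u).integrable one_le_two) (topProj u d)
  have h2 := M.abs_value_triggered_precomp_sub_le hL hL0 hB (topProj u d) T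
  rw [triggered_precomp_eq πb f (topProj u d)
    fun t h ↦ topProj_eq_zero_of_mem_botSpace u d (hf t h)] at h2
  have h3 : L / (1 - M.γ) ^ 2 * ∫ s, ‖s - topProj u d s‖ ∂(M.occupancy πs.toHPolicy) ≤ _ :=
    mul_le_mul_of_nonneg_left (integral_norm_sub_topProj_le hν hu d) (by positivity)
  rw [← hopt]
  linarith [le_abs_self (M.value πs.toHPolicy - M.value (πb.precomp (topProj u d)).toHPolicy),
    le_abs_self (M.value (πb.precomp (topProj u d)).toHPolicy
      - M.value ((πb.precomp T).triggered f))]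

/-- Since `5 ≤ e ^ 2`, an exponent of `2 * D + log (2 / δ)` beats both the net and the two tails;
`384 = 2 * 192` provides it. -/
lemma net_card_mul_exp_le {x δ : ℝ} (hδ : 0 < δ) (hδ1 : δ ≤ 1)
    (hx : 384 * (D + Real.log (2 / δ)) ≤ x) : 5 ^ D * (2 * Real.exp (-(x / 192))) ≤ δ := by
  have hlog : 0 ≤ Real.log (2 / δ) := Real.log_nonneg (by rw [le_div_iff₀ hδ]; linarith)
  have hE : Real.exp (-(x / 192)) ≤ Real.exp (-(D * 2)) * (δ / 2) := by
    have : δ / 2 = Real.exp (-Real.log (2 / δ)) := by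
      rw [Real.exp_neg, Real.exp_log (by positivity), inv_div]
    rw [this, ← Real.exp_add]
    exact Real.exp_le_exp.2 (by linarith)
  have h5 : (5 : ℝ) ^ D ≤ Real.exp (D * 2) := by
    rw [Real.exp_nat_mul]
    refine pow_le_pow_left₀ (by norm_num) ?_ D
    have := Real.quadratic_le_exp_of_nonneg (x := 2) (by norm_num)
    linarith
  calc 5 ^ D * (2 * Real.exp (-(x / 192)))
      ≤ Real.exp (D * 2) * (2 * (Real.exp (-(D * 2)) * (δ / 2))) := by gcongr
    _ = (Real.exp (D * 2) * Real.exp (-(D * 2))) * δ := by ring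
    _ = δ := by rw [← Real.exp_add, add_neg_cancel, Real.exp_zero, one_mul]

end

end Backdoor

end

/-! ### The main theorem: choice of the accuracy and of the constant. -/

open Backdoor in
theorem theorem1 :
    ∃ C : ℝ, 0 < C ∧
    ∀ (D d : ℕ) (hd : 1 ≤ d) (hdD : d < D)
      (A : Type*) [Countable A] [MeasurableSpace A] [DiscreteMeasurableSpace A]
      (M : MDP D A)
      -- the optimal policy the attacker starts from, and the backdoor policy
      (πs πb : Policy D A)
      (_ : M.value πs.toHPolicy = M.optValue)
      (_ : ∀ s ∈ (M.occupancy πs.toHPolicy).support, πb.act s = πs.act s)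
      (_ : ∫ s, s ∂(M.occupancy πs.toHPolicy) = 0)
      -- eigendecomposition of the clean covariance matrix, with an eigengap
      (u : OrthonormalBasis (Fin D) ℝ (State D)) (lam : Fin D → ℝ)
      (_ : IsEigenDecomp (secondMoment (M.occupancy πs.toHPolicy)) u lam)
      (_ : 0 < lam ⟨d - 1, by omega⟩ - lam ⟨d, hdD⟩)
      -- bounded support along the complement of the safe subspace, and sub-Gaussianity
      (_ : ∃ C₀ : ℝ, ∀ᵐ s ∂(M.occupancy πs.toHPolicy), ‖botProj u d s‖ ≤ C₀)
      (K : ℝ) (_ : IsSubGaussian (M.occupancy πs.toHPolicy) K)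
      -- Lipschitz backdoor policy
      (L : ℝ) (_ : πb.IsLipschitz L)
      -- subspace trigger, bounded in expectation
      (f : Trigger D) (_ : ∀ t h, f.fn t h ∈ botSpace u d)
      (B : ℝ) (_ : f.IsBoundedInExpectation M B)
      (ε δ : ℝ) (_ : 0 < ε) (_ : 0 < δ)
      -- i.i.d. clean samples
      (n : ℕ)
      (_ : C * d * B ^ 2 * L ^ 2 * K ^ 4
            * specNorm (secondMoment (M.occupancy πs.toHPolicy)) ^ 2
            / ((lam ⟨d - 1, by omega⟩ - lam ⟨d, hdD⟩) ^ 2 * (1 - M.γ) ^ 4 * ε ^ 2)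
            * (D + Real.log (2 / δ)) ≤ n)
      (Ω : Type*) [MeasurableSpace Ω] (Pr : Measure Ω) [IsProbabilityMeasure Pr]
      (X : Fin n → Ω → State D)
      (_ : iIndepFun X Pr) (_ : ∀ j, HasLaw (X j) (M.occupancy πb.toHPolicy) Pr),
      ∃ G : Set Ω, MeasurableSet G ∧ ENNReal.ofReal (1 - δ) ≤ Pr G ∧
        ∀ ω ∈ G, ∀ (v : OrthonormalBasis (Fin D) ℝ (State D)) (lamhat : Fin D → ℝ),
          IsEigenDecomp (empCov fun j ↦ X j ω) v lamhat →
          M.optValue - M.value ((πb.precomp (topProj v d)).triggered f)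
            ≤ L / (1 - M.γ) ^ 2 * √(∑ i ∈ Finset.univ.filter (fun i : Fin D ↦ d ≤ (i : ℕ)), lam i) + ε := by
  -- The factors are `384` from `net_card_mul_exp_le`, `8` from Davis–Kahan, `1024 = 32 ^ 2` from
  -- the net, and `16` from `t ^ 4 = 16 * K ^ 4 * N ^ 2`.
  refine ⟨384 * 8 * 1024 * 16, by norm_num, ?_⟩
  intro D d hd hdD A _ _ _ M πs πb hopt hsupp _ u lam hu hgap _ K hK L hL f hf B hB ε δ hε hδ n hn
    Ω _ Pr _ X hind hlaw
  have hagree : ∀ᵐ s ∂(M.occupancy πs.toHPolicy), πb.act s = πs.act s := by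
    filter_upwards [Measure.support_mem_ae] with s hs using hsupp s hs
  rw [M.occupancy_congr πs πb hagree] at hlaw
  have hL0 : 0 ≤ L := hL.nonneg (by omega)
  have hB0 : 0 ≤ B := (integral_nonneg fun _ ↦ norm_nonneg _).trans (hB πs 0).2
  have hγ : 0 < 1 - M.γ := sub_pos.2 M.γ_lt_one
  have hmain := fun T ↦ optValue_sub_value_le M hopt hagree hK.memLp hu d hL hL0 hf hB T
  rcases le_or_gt 1 δ with hδ1 | hδ1
  · exact ⟨∅, .empty, by simp [ENNReal.ofReal_of_nonpos (sub_nonpos.2 hδ1)], by simp⟩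
  -- If `ε` is large, two projections differing by at most `2` in norm is enough and no samples are
  -- needed. Otherwise `L * B > 0`, and the accuracy `η` below stays within Bernstein's range `η ≤
  -- 1`.
  rcases le_or_gt (2 * (L * B)) (ε * (1 - M.γ) ^ 2) with hsmall | hbig
  · refine ⟨Set.univ, .univ, by simpa using hδ.le, fun ω _ v _ _ ↦ (hmain _).trans ?_⟩
    gcongr
    rw [div_le_iff₀ (by positivity)]
    have : ‖topProj u d - topProj v d‖ ≤ 2 :=
      (norm_sub_le _ _).trans (by linarith [norm_topProj_le u d, norm_topProj_le v d])
    have := mul_le_mul_of_nonneg_left this (mul_nonneg hL0 hB0)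
    linarith
  have hLB : 0 < L * B := by
    have : 0 < ε * (1 - M.γ) ^ 2 := by positivity
    linarith
  set ν := M.occupancy πs.toHPolicy with hνdef
  set N := specNorm (secondMoment ν) with hN
  set gap := lam ⟨d - 1, by omega⟩ - lam ⟨d, hdD⟩ with hgapdef
  have hlam : ∀ i, lam i = ∫ s, inner ℝ s (u i) ^ 2 ∂ν := fun i ↦ by
    rw [← hu.inner_basis i, inner_toOp_secondMoment hK.memLp]
  have hlam0 : 0 ≤ lam ⟨d, hdD⟩ := by
    rw [hlam]; exact integral_nonneg fun _ ↦ sq_nonneg _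
  have hgapN : gap ≤ N := by
    have h1 : lam ⟨d - 1, by omega⟩ ≤ N := by
      rw [← hu.inner_basis]
      refine (real_inner_le_norm _ _).trans ?_
      have := (toOp (secondMoment ν)).le_opNorm (u ⟨d - 1, by omega⟩)
      rw [u.norm_eq_one, mul_one] at this
      rw [u.norm_eq_one, one_mul]
      exact this
    linarith
  have hN0 : 0 < N := hgap.trans_le hgapN
  have hK1 : 1 ≤ K := hK.one_le (y := u ⟨d - 1, by omega⟩) (by rw [← hlam]; linarith)
  have hK0 : 0 < K := by linarith
  set t := 2 * K * √N with ht
  have ht0 : 0 < t := by positivity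
  have ht2 : t ^ 2 = 4 * K ^ 2 * N := by rw [ht, mul_pow, Real.sq_sqrt hN0.le]; ring
  have hd0 : (0 : ℝ) < d := by exact_mod_cast hd
  have hd1 : (1 : ℝ) ≤ d := by exact_mod_cast hd
  have hsd : 1 ≤ √(8 * d : ℝ) := Real.one_le_sqrt.2 (by linarith)
  set den := √(8 * d : ℝ) * (32 * t ^ 2) * (L * B) with hden
  have hden0 : 0 < den := by positivity
  -- Chosen so that covariance error `32 * t ^ 2 * η`, passed through Davis–Kahan and the value
  -- comparison, costs exactly `ε`.
  set η := ε * (1 - M.γ) ^ 2 * gap / den with hη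
  have hη0 : 0 < η := by positivity
  have hη1 : η ≤ 1 := by
    rw [hη, div_le_one hden0]
    have hgt : gap ≤ t ^ 2 := by rw [ht2]; nlinarith [mul_le_mul hK1 hK1 zero_le_one hK0.le]
    calc ε * (1 - M.γ) ^ 2 * gap ≤ (2 * (L * B)) * t ^ 2 := by gcongr
      _ ≤ 1 * (32 * t ^ 2) * (L * B) := by nlinarith [mul_pos (pow_pos ht0 2) hLB]
      _ ≤ den := by rw [hden]; gcongr
  have hden2 : den ^ 2 = 8 * d * (1024 * (16 * K ^ 4 * N ^ 2)) * (L ^ 2 * B ^ 2) := by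
    rw [hden, mul_pow, mul_pow, mul_pow, Real.sq_sqrt (by positivity), ht2]; ring
  have hnη : 384 * (D + Real.log (2 / δ)) ≤ n * η ^ 2 := by
    have h1 := mul_le_mul_of_nonneg_right hn (sq_nonneg η)
    refine le_trans (le_of_eq ?_) h1
    have hL' : L ≠ 0 := fun h ↦ by simp [h] at hLB
    have hB' : B ≠ 0 := fun h ↦ by simp [h] at hLB
    rw [hη, div_pow, hden2]
    field_simp
  have hlog : 0 ≤ Real.log (2 / δ) := Real.log_nonneg (by rw [le_div_iff₀ hδ]; linarith)
  have hD0 : (0 : ℝ) < D := by exact_mod_cast (by omega : 0 < D)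
  have hnpos : 0 < n := by
    rcases Nat.eq_zero_or_pos n with h0 | h0
    · rw [h0, Nat.cast_zero, zero_mul] at hnη
      linarith
    · exact h0
  obtain ⟨G, hGm, hGp, hG⟩ := exists_event_norm_sub_le ht0 hK.memLp
    (fun y hy ↦ hK.lintegral_exp_le hK1 hN0 hy) hnpos hind hlaw hη0.le hη1
    (net_card_mul_exp_le hδ hδ1.le hnη)
  refine ⟨G, hGm, hGp, fun ω hω v mu hv ↦ (hmain _).trans ?_⟩
  gcongr
  have hdk := hu.gap_sq_mul_norm_topProj_sub_sq_le hv (Nat.sub_add_cancel hd) rfl hgap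
  have hle : gap * ‖topProj u d - topProj v d‖ ≤ √(8 * d : ℝ) * (32 * (t ^ 2 * η)) := by
    refine le_of_sq_le_sq ?_ (by positivity)
    rw [mul_pow, mul_pow, Real.sq_sqrt (by positivity)]
    refine hdk.trans ?_
    gcongr
    exact hG ω hω
  rw [div_le_iff₀ (by positivity)]
  refine le_of_mul_le_mul_left ?_ hgap
  calc gap * (L * B * ‖topProj u d - topProj v d‖)
      = (L * B) * (gap * ‖topProj u d - topProj v d‖) := by ring
    _ ≤ (L * B) * (√(8 * d : ℝ) * (32 * (t ^ 2 * η))) := by gcongr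
    _ = den * η := by rw [hden]; ring
    _ = ε * (1 - M.γ) ^ 2 * gap := by rw [hη]; field_simp
    _ = gap * (ε * (1 - M.γ) ^ 2) := by ring
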